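/- For a positive integer $n$, let $X(n)$ denote the multiset of the degrees of the irreducible complex characters of the symmetric group $S_n$ (each irreducible character contributing its degree once), and let $m(n)$ denote the largest of the multiplicities of the elements of $X(n)$. Then: 1. for all sufficiently large integers $i$ and all integers $n$, if $n\ge 3\cdot 81^i$ then $m(n)\ge 2^i$; 2. in particular, for all sufficiently large integers $n$, $m(n)\ge n^{1/7}$. -/

import Mathlib

/-- The set of irreducible (complex) characters of a group `G`, as functions `G → ℂ`: the
characters of the irreducible finite-dimensional complex representations of `G`. -/
def irreducibleCharacters (G : Type*) [Group G] : Set (G → ℂ) :=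
  {χ | ∃ (V : Type) (_ : AddCommGroup V) (_ : Module ℂ V) (_ : FiniteDimensional ℂ V)
    (ρ : Representation ℂ G V), ρ.IsIrreducible ∧ ρ.character = χ}

/-- A finite group has finitely many irreducible characters (they are linearly independent). -/
theorem finite_irreducibleCharacters (G : Type*) [Group G] [Finite G] :
    (irreducibleCharacters G).Finite := by
  classical
  let _ : Fintype G := Fintype.ofFinite G
  have hcard : (Nat.card G : ℂ) ≠ 0 := Nat.cast_ne_zero.mpr Nat.card_pos.ne'
  let _ : Invertible (Nat.card G : ℂ) := invertibleOfNonzero hcard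
  have orth : ∀ χ ∈ irreducibleCharacters G, ∀ ψ ∈ irreducibleCharacters G,
      (Nat.card G : ℂ)⁻¹ * ∑ g : G, χ g * ψ g⁻¹ = if χ = ψ then 1 else 0 := by
    rintro χ ⟨V, _, _, _, ρ, hρ, rfl⟩ ψ ⟨W, _, _, _, σ, hσ, rfl⟩
    by_cases h : ρ.character = σ.character
    · rw [if_pos h, ← h, Representation.char_orthonormal ρ ρ,
        if_pos ⟨Representation.Equiv.refl ρ⟩]
    · rw [if_neg h, Representation.char_orthonormal ρ σ, if_neg]
      rintro ⟨e⟩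
      exact h (Representation.char_iso e).symm
  have hli : LinearIndependent ℂ (fun χ : irreducibleCharacters G => (χ : G → ℂ)) := by
    rw [linearIndependent_iff']
    intro s c hs ψ hψ
    have h0 : (Nat.card G : ℂ)⁻¹ *
        ∑ g : G, (∑ χ ∈ s, c χ • (χ : G → ℂ)) g * (ψ : G → ℂ) g⁻¹ = 0 := by
      rw [hs]
      simp
    have h1 : (Nat.card G : ℂ)⁻¹ *
        ∑ g : G, (∑ χ ∈ s, c χ • (χ : G → ℂ)) g * (ψ : G → ℂ) g⁻¹ =
        ∑ χ ∈ s, c χ * ((Nat.card G : ℂ)⁻¹ * ∑ g : G, (χ : G → ℂ) g * (ψ : G → ℂ) g⁻¹) := by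
      simp only [Finset.sum_apply, Pi.smul_apply, smul_eq_mul, Finset.sum_mul, Finset.mul_sum]
      rw [Finset.sum_comm]
      refine Finset.sum_congr rfl fun χ _ => Finset.sum_congr rfl fun g _ => ?_
      ring
    rw [h1] at h0
    simp only [orth _ (Subtype.prop _) _ ψ.2] at h0
    simpa [Subtype.coe_inj, hψ] using h0
  have := hli.finite
  exact Set.toFinite _

/-- The multiset `X(n)` of the degrees `χ(1)` of the irreducible characters `χ` of the symmetric
group `S_n`, each degree occurring once for every irreducible character having it. -/
noncomputable def symDegrees (n : ℕ) : Multiset ℂ :=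
  (finite_irreducibleCharacters (Equiv.Perm (Fin n))).toFinset.val.map fun χ => χ 1

open Classical in
/-- `m(n)`: the largest of the multiplicities of the elements of the multiset `X(n)`. -/
noncomputable def maxDegreeMultiplicity (n : ℕ) : ℕ :=
  (symDegrees n).toFinset.sup fun d => (symDegrees n).count d

/-!
The irreducible characters of `S_n` are indexed by partitions of `n`, and the degree of each is
`n!` divided by the product of its hook lengths. It suffices to find, for every `n ≥ 6 * 25 ^ i`,
`2 ^ i` partitions of `n` with the same multiset of hook lengths: `3 * 81 ^ i ≥ 6 * 25 ^ i` gives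
the first claim, and the second follows because `243 * 81 ^ i ≤ (2 ^ i) ^ 7` for `i ≥ 13`.

**Partitions with equal hook lengths.** A partition with beta numbers (first column hook lengths)
`L` is recorded by its corner polynomial `E = 1 + (X - 1) * ∑ x ∈ L, X ^ x`, whose nonzero
coefficients alternate between `1` and `-1` and mark the corners of the diagram. The number of hooks
of length `d` is a linear function of the autocorrelation `E(X) * E(1 / X)`
(`hookCount_eq_of_mul_reflect_eq`), so the hook lengths do not change if a factor of `E` is
reversed. A product `E * F` is again a corner polynomial as soon as the gaps between the exponents
of `F` are at least the degree of `E` (`cornerPoly_insertRun`). So the products of the corner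
polynomials `1 - X ^ a + X ^ (3 * a)` of `a × 2a` rectangles, `a = 1, 5, …, 5 ^ (i - 1)`, with any subset of the
factors reversed, give `2 ^ i` partitions with the same hook lengths (`exists_isHookFamily`). The
size of the partition is additive under products, being a variance up to a factor. A last factor
with two corners and long sides, which exists in every size `≥ 5 * 25 ^ i`, brings the size to `n`
(`exists_isHookFamily_of_le`).

**The characters.** Following Frobenius, for strictly increasing beta numbers `l` one takes the
alternating sum `∑ w, sign w * π (l - w)` of permutation characters on colorings of `n` points.
By Burnside's lemma, scalar products of the `π α` count matrices with given margins, that is, they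
are the coefficients of `∏ 1 / (1 - x i * y j)`; Cauchy's determinant then shows that the
alternating sums are orthonormal (`sum_frobeniusCharacter_mul`). An integral combination of
characters of norm one with positive value at `1` is an irreducible character
(`mem_irreducibleCharacters_of_norm_one`). At the identity the alternating sum is a determinant of
Vandermonde type (`frobeniusCharacter_one_mul_prod_factorial`), which is the hook length formula
(`frobeniusCharacter_one_mul_prod_hooks`).
-/

namespace SymmetricGroupDegrees

/-! ### Irreducible characters among the integral combinations of characters -/

section Characters

variable {G : Type*} [Group G] [Finite G]

/-- By Maschke's theorem, every character is a sum of irreducible characters. -/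
theorem character_mem_closure_irreducibleCharacters
    (V : Type) [AddCommGroup V] [Module ℂ V] [FiniteDimensional ℂ V] (ρ : Representation ℂ G V) :
    ρ.character ∈ AddSubgroup.closure (irreducibleCharacters G) := by
  have hcard : NeZero (Nat.card G : ℂ) := ⟨Nat.cast_ne_zero.mpr Nat.card_pos.ne'⟩
  induction hd : Module.finrank ℂ V using Nat.strong_induction_on generalizing V with
  | _ d ih =>
    by_cases hirr : ρ.IsIrreducible
    · exact AddSubgroup.subset_closure ⟨V, _, _, inferInstance, ρ, hirr, rfl⟩
    by_cases hnt : Nontrivial (Subrepresentation ρ)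
    · -- a proper nonzero subrepresentation has a complement, and the character is the sum
      obtain ⟨W, hW0, hW1⟩ : ∃ W : Subrepresentation ρ, W ≠ ⊥ ∧ W ≠ ⊤ := by
        by_contra! h
        exact hirr ⟨fun W => or_iff_not_imp_left.2 (h W)⟩
      obtain ⟨U, hU⟩ := exists_isCompl W
      have hc : IsCompl W.toSubmodule U.toSubmodule := by
        constructor
        · rw [disjoint_iff]
          exact congrArg Subrepresentation.toSubmodule hU.inf_eq_bot
        · rw [codisjoint_iff]
          exact congrArg Subrepresentation.toSubmodule hU.sup_eq_top
      have hW0' : W.toSubmodule ≠ ⊥ := fun h =>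
        hW0 (Subrepresentation.toSubmodule_injective h)
      have hW1' : W.toSubmodule ≠ ⊤ := fun h =>
        hW1 (Subrepresentation.toSubmodule_injective h)
      have hsum := Submodule.finrank_add_eq_of_isCompl hc
      have hpos : 0 < Module.finrank ℂ W.toSubmodule :=
        Nat.pos_of_ne_zero fun h => hW0' (Submodule.finrank_eq_zero.1 h)
      have hlt : Module.finrank ℂ W.toSubmodule < Module.finrank ℂ V :=
        Submodule.finrank_lt hW1'
      have h1 := ih _ (by omega) W.toSubmodule W.toRepresentation rfl
      have h2 := ih _ (by omega) U.toSubmodule U.toRepresentation rfl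
      have : ρ.character = W.toRepresentation.character + U.toRepresentation.character := by
        funext g
        have hint : DirectSum.IsInternal
            (fun b : Bool => if b then W.toSubmodule else U.toSubmodule) := by
          refine (DirectSum.isInternal_submodule_iff_isCompl _ (i := true) (j := false)
            (by simp) (by ext b; cases b <;> simp)).2 (by simpa using hc)
        have hmaps : ∀ b : Bool, Set.MapsTo (ρ g)
            ((if b then W.toSubmodule else U.toSubmodule : Submodule ℂ V) : Set V)
            ((if b then W.toSubmodule else U.toSubmodule : Submodule ℂ V) : Set V) := by
          intro b
          cases b
          · exact U.apply_mem_toSubmodule g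
          · exact W.apply_mem_toSubmodule g
        have := LinearMap.trace_eq_sum_trace_restrict hint hmaps
        rw [Fintype.sum_bool] at this
        exact this
      rw [this]
      exact add_mem h1 h2
    · -- the zero representation
      have : ρ.character = 0 := by
        have hV : Subsingleton V := by
          by_contra h
          rw [not_subsingleton_iff_nontrivial] at h
          refine hnt ⟨⊥, ⊤, fun h' => ?_⟩
          exact bot_ne_top (congrArg Subrepresentation.toSubmodule h' : (⊥ : Submodule ℂ V) = ⊤)
        funext g
        have : ρ g = 0 := Subsingleton.elim _ _
        simp [Representation.character, this]
      rw [this]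
      exact zero_mem _

theorem irreducibleCharacters_orthonormal [Fintype G] {χ ψ : G → ℂ}
    (hχ : χ ∈ irreducibleCharacters G) (hψ : ψ ∈ irreducibleCharacters G) [Decidable (χ = ψ)] :
    ∑ g : G, χ g * ψ g⁻¹ = if χ = ψ then (Nat.card G : ℂ) else 0 := by
  classical
  have hcard : (Nat.card G : ℂ) ≠ 0 := Nat.cast_ne_zero.mpr Nat.card_pos.ne'
  let _ : Invertible (Nat.card G : ℂ) := invertibleOfNonzero hcard
  obtain ⟨V, _, _, _, ρ, hρ, rfl⟩ := hχ
  obtain ⟨W, _, _, _, σ, hσ, rfl⟩ := hψ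
  by_cases h : ρ.character = σ.character
  · rw [if_pos h, ← mul_one (Nat.card G : ℂ), ← inv_mul_eq_iff_eq_mul₀ hcard, ← h,
      Representation.char_orthonormal ρ ρ, if_pos ⟨Representation.Equiv.refl ρ⟩]
  · rw [if_neg h, ← mul_zero (Nat.card G : ℂ), ← inv_mul_eq_iff_eq_mul₀ hcard,
      Representation.char_orthonormal ρ σ, if_neg]
    rintro ⟨e⟩
    exact h (Representation.char_iso e).symm

/-- A virtual character `∑ a χ • χ` of norm `∑ (a χ) ^ 2 = 1` is an irreducible character up to
sign, and the sign is the one of its value at `1`. -/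
theorem mem_irreducibleCharacters_of_norm_one [Fintype G] {θ : G → ℂ}
    (hθ : θ ∈ AddSubgroup.closure (irreducibleCharacters G))
    (hnorm : ∑ g : G, θ g * θ g⁻¹ = Nat.card G) {d : ℕ} (hd0 : 0 < d)
    (hd : θ 1 = d) :
    θ ∈ irreducibleCharacters G := by
  classical
  have hcard : (Nat.card G : ℂ) ≠ 0 := Nat.cast_ne_zero.mpr Nat.card_pos.ne'
  obtain ⟨a, ha⟩ : ∃ a : (G → ℂ) → ℤ,
      θ = ∑ χ ∈ (finite_irreducibleCharacters G).toFinset, a χ • χ := by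
    clear hnorm hd
    induction hθ using AddSubgroup.closure_induction with
    | mem x hx =>
      refine ⟨Pi.single x 1, ?_⟩
      rw [Finset.sum_eq_single x]
      · simp
      · intro b _ hb
        simp [hb]
      · intro h
        simp [hx] at h
    | zero => exact ⟨0, by simp⟩
    | add x y _ _ hx hy =>
      obtain ⟨a, rfl⟩ := hx
      obtain ⟨b, rfl⟩ := hy
      exact ⟨a + b, by simp [add_smul, Finset.sum_add_distrib]⟩
    | neg x _ hx =>
      obtain ⟨a, rfl⟩ := hx
      exact ⟨-a, by simp⟩
  set s := (finite_irreducibleCharacters G).toFinset with hs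
  have hmem : ∀ χ ∈ s, χ ∈ irreducibleCharacters G := by simp [hs]
  have hsq : ∑ χ ∈ s, a χ ^ 2 = 1 := by
    have h1 : ∑ g : G, θ g * θ g⁻¹ =
        ∑ χ ∈ s, ∑ ψ ∈ s, (a χ : ℂ) * a ψ * ∑ g : G, χ g * ψ g⁻¹ := by
      simp only [ha, Finset.sum_apply, zsmul_eq_mul, Finset.sum_mul_sum]
      rw [Finset.sum_comm]
      refine Finset.sum_congr rfl fun χ _ => ?_
      rw [Finset.sum_comm]
      refine Finset.sum_congr rfl fun ψ _ => ?_
      rw [Finset.mul_sum]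
      refine Finset.sum_congr rfl fun g _ => ?_
      simp only [Pi.mul_apply, Pi.intCast_apply]
      ring
    have h2 : ∀ χ ∈ s, ∑ ψ ∈ s, (a χ : ℂ) * a ψ * ∑ g : G, χ g * ψ g⁻¹ =
        (a χ : ℂ) ^ 2 * Nat.card G := by
      intro χ hχ
      rw [Finset.sum_eq_single χ]
      · rw [irreducibleCharacters_orthonormal (hmem χ hχ) (hmem χ hχ), if_pos rfl, sq]
      · intro ψ hψ hne
        rw [irreducibleCharacters_orthonormal (hmem χ hχ) (hmem ψ hψ), if_neg hne.symm, mul_zero]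
      · exact fun h => (h hχ).elim
    rw [hnorm, Finset.sum_congr rfl h2, ← Finset.sum_mul] at h1
    have h3 : (∑ χ ∈ s, (a χ : ℂ) ^ 2) = 1 := by
      have := mul_right_cancel₀ hcard ((one_mul _).trans h1)
      exact this.symm
    exact_mod_cast h3
  -- exactly one coefficient is nonzero, and it is `1` or `-1`
  obtain ⟨χ, hχ, hχ0⟩ : ∃ χ ∈ s, a χ ≠ 0 := by
    by_contra! h
    rw [Finset.sum_eq_zero fun χ hχ => by rw [h χ hχ]; rfl] at hsq
    exact zero_ne_one hsq
  have hsplit := Finset.add_sum_erase s (fun χ => a χ ^ 2) hχ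
  have hge : 1 ≤ a χ ^ 2 := by
    have := sq_nonneg (a χ)
    have h0 : a χ ^ 2 ≠ 0 := pow_ne_zero 2 hχ0
    omega
  have hrest0 : 0 ≤ ∑ χ ∈ s.erase χ, a χ ^ 2 := Finset.sum_nonneg fun _ _ => sq_nonneg _
  have hzero : ∀ ψ ∈ s.erase χ, a ψ = 0 := by
    have hz : ∑ χ ∈ s.erase χ, a χ ^ 2 = 0 := by
      omega
    intro ψ hψ
    have := (Finset.sum_eq_zero_iff_of_nonneg fun _ _ => sq_nonneg _).1 hz ψ hψ
    exact pow_eq_zero_iff two_ne_zero |>.1 this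
  have hθχ : θ = a χ • χ := by
    rw [ha, ← Finset.add_sum_erase _ _ hχ, Finset.sum_eq_zero, add_zero]
    intro ψ hψ
    rw [hzero ψ hψ, zero_smul]
  have ha1 : a χ ^ 2 = 1 := by
    omega
  rcases (sq_eq_sq_iff_eq_or_eq_neg.1 (ha1.trans (one_pow 2).symm)) with h | h
  · rw [hθχ, h, one_smul]
    exact hmem χ hχ
  · exfalso
    obtain ⟨V, _, _, _, ρ, hρ, rfl⟩ := hmem χ hχ
    rw [hθχ, h] at hd
    simp only [Pi.smul_apply, Representation.char_one, neg_smul, one_smul] at hd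
    have : (Module.finrank ℂ V : ℂ) + d = 0 := by rw [← hd]; simp
    norm_cast at this
    omega

end Characters

/-- The number of fixed points of a permutation action is the character of its permutation
representation. -/
theorem permutationCharacter_mem_closure {G : Type*} [Group G] [Finite G]
    {X : Type} [Fintype X] [DecidableEq X] (φ : G →* Equiv.Perm X) :
    (fun g => (Fintype.card {x // φ g x = x} : ℂ)) ∈
      AddSubgroup.closure (irreducibleCharacters G) := by
  let ρ : Representation ℂ G (X → ℂ) :=
    { toFun := fun g => LinearMap.funLeft ℂ ℂ (φ g⁻¹)
      map_one' := by
        refine LinearMap.ext fun f => funext fun x => ?_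
        simp [LinearMap.funLeft_apply]
      map_mul' := fun g h => by
        refine LinearMap.ext fun f => funext fun x => ?_
        simp [LinearMap.funLeft_apply] }
  convert character_mem_closure_irreducibleCharacters (X → ℂ) ρ using 1
  funext g
  rw [Representation.character, LinearMap.trace_eq_matrix_trace ℂ (Pi.basisFun ℂ X),
    Matrix.trace]
  simp only [Matrix.diag_apply, LinearMap.toMatrix_apply, Pi.basisFun_apply, Pi.basisFun_repr]
  have : ∀ x, ρ g (Pi.single x 1) x = if φ g x = x then (1 : ℂ) else 0 := by
    intro x
    change (Pi.single x 1 : X → ℂ) (φ g⁻¹ x) = _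
    rw [Pi.single_apply, map_inv]
    congr 1
    exact propext (Equiv.Perm.inv_eq_iff_eq.trans eq_comm)
  simp only [this]
  rw [Finset.sum_boole, Fintype.card_subtype]

/-! ### Colorings and their contents -/

section Colorings

open Finset

/-- The content of a coloring `c`: the number of points of each color. -/
def content {ι κ : Type*} [Fintype ι] [DecidableEq κ] (c : ι → κ) (k : κ) : ℕ :=
  #{a | c a = k}

variable {ι κ : Type*} [Fintype ι] [DecidableEq ι] [DecidableEq κ]

omit [DecidableEq ι] in
theorem content_comp_perm (c : ι → κ) (σ : Equiv.Perm ι) : content (c ∘ σ) = content c := by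
  funext k
  refine card_bij (fun a _ => σ a) ?_ (fun a _ b _ h => σ.injective h) ?_
  · intro a ha
    simpa using ha
  · intro b hb
    exact ⟨σ.symm b, by simpa using hb, by simp⟩

omit [DecidableEq ι] in
theorem exists_perm_of_content_eq {c d : ι → κ} (h : content c = content d) :
    ∃ σ : Equiv.Perm ι, c ∘ σ = d := by
  have e : ∀ k, Nonempty ({a // d a = k} ≃ {a // c a = k}) := by
    intro k
    rw [← Fintype.card_eq, Fintype.card_subtype, Fintype.card_subtype]
    exact (congrFun h k).symm
  exact ⟨Equiv.ofFiberEquiv fun k => (e k).some,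
    funext fun a => Equiv.ofFiberEquiv_map (fun k => (e k).some) a⟩

omit [DecidableEq ι] in
theorem exists_content_eq [Fintype κ] {M : κ → ℕ} (hM : ∑ k, M k = Fintype.card ι) :
    ∃ c : ι → κ, content c = M := by
  have e : Nonempty (ι ≃ Σ k, Fin (M k)) := by
    rw [← Fintype.card_eq]
    simp [hM]
  obtain ⟨e⟩ := e
  refine ⟨fun a => (e a).1, funext fun k => ?_⟩
  rw [content, ← Fintype.card_subtype]
  have e2 : {a // (e a).1 = k} ≃ {x : Σ k, Fin (M k) // x.1 = k} :=
    e.subtypeEquiv fun a => Iff.rfl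
  rw [Fintype.card_congr (e2.trans (Equiv.sigmaSubtype k)), Fintype.card_fin]

theorem card_perm_fixing_coloring [Fintype κ] (c : ι → κ) :
    #{σ : Equiv.Perm ι | c ∘ σ = c} = ∏ k, (content c k).factorial := by
  rw [← Fintype.card_subtype, DomMulAct.stabilizer_card]
  exact prod_congr rfl fun k _ => by rw [Fintype.card_subtype, content]

/-- The number of colorings of given content is a multinomial coefficient: permutations act
transitively on them. -/
theorem card_colorings_mul_prod_factorial [Fintype κ] {M : κ → ℕ}
    (hM : ∑ k, M k = Fintype.card ι) :
    #{c : ι → κ | content c = M} * ∏ k, (M k).factorial = (Fintype.card ι).factorial := by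
  obtain ⟨c, rfl⟩ := exists_content_eq hM
  have h := card_eq_sum_card_fiberwise (s := (univ : Finset (Equiv.Perm ι)))
    (t := ({d : ι → κ | content d = content c} : Finset _)) (f := fun σ : Equiv.Perm ι => c ∘ ⇑σ)
    (fun σ _ => by simp [content_comp_perm])
  rw [card_univ, Fintype.card_perm] at h
  rw [h, ← smul_eq_mul, ← sum_const]
  refine sum_congr rfl fun d hd => ?_
  obtain ⟨τ, rfl⟩ := exists_perm_of_content_eq (mem_filter.1 hd).2.symm
  rw [← card_perm_fixing_coloring]
  refine card_bij (fun σ _ => σ * τ) ?_ (fun a _ b _ h => mul_right_cancel h) ?_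
  · intro σ hσ
    have : c ∘ σ = c := by simpa using hσ
    simp only [mem_filter, mem_univ, true_and, Equiv.Perm.coe_mul, ← Function.comp_assoc, this]
  · intro σ hσ
    have : c ∘ σ = c ∘ τ := by simpa using hσ
    refine ⟨σ * τ⁻¹, ?_, by simp⟩
    simp only [mem_filter, mem_univ, true_and, Equiv.Perm.coe_mul, ← Function.comp_assoc, this]
    funext a
    simp

/-- Colorings of a given content form a single orbit, so they are fixed by one permutation on
average. -/
theorem sum_perm_card_fixed_colorings [Fintype κ] {M : κ → ℕ}
    (hM : ∑ k, M k = Fintype.card ι) :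
    ∑ σ : Equiv.Perm ι, #{c : ι → κ | content c = M ∧ c ∘ σ = c} =
      (Fintype.card ι).factorial := by
  have h : ∀ σ : Equiv.Perm ι, #{c : ι → κ | content c = M ∧ c ∘ σ = c} =
      ∑ c ∈ ({c : ι → κ | content c = M} : Finset _), if c ∘ σ = c then 1 else 0 := by
    intro σ
    rw [← filter_filter, card_filter]
  simp only [h]
  rw [sum_comm, ← card_colorings_mul_prod_factorial hM, ← smul_eq_mul, ← sum_const]
  refine sum_congr rfl fun c hc => ?_
  rw [← card_filter, card_perm_fixing_coloring, (mem_filter.1 hc).2]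

variable {κ₁ κ₂ : Type*} [DecidableEq κ₁] [DecidableEq κ₂]

omit [DecidableEq ι] in
theorem content_fst [Fintype κ₂] (c : ι → κ₁ × κ₂) (i : κ₁) :
    content (fun a => (c a).1) i = ∑ j, content c (i, j) := by
  simp only [content]
  rw [card_eq_sum_card_fiberwise (f := fun a => (c a).2) fun a _ => mem_univ _]
  refine sum_congr rfl fun j _ => ?_
  rw [filter_filter]
  congr 1
  ext a
  simp [Prod.ext_iff]

omit [DecidableEq ι] in
theorem content_snd [Fintype κ₁] (c : ι → κ₁ × κ₂) (j : κ₂) :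
    content (fun a => (c a).2) j = ∑ i, content c (i, j) := by
  simp only [content]
  rw [card_eq_sum_card_fiberwise (f := fun a => (c a).1) fun a _ => mem_univ _]
  refine sum_congr rfl fun i _ => ?_
  rw [filter_filter]
  congr 1
  ext a
  simp [Prod.ext_iff, and_comm]

/-- Burnside's lemma for pairs of colorings: the orbits are the contents of the pairs, that is, the
matrices with prescribed margins `α` and `β`, listed by the finite set `S`. -/
theorem sum_perm_card_fixed_mul_card_fixed [Fintype κ₁] [Fintype κ₂] {α : κ₁ → ℕ} {β : κ₂ → ℕ}
    (hα : ∑ i, α i = Fintype.card ι) (S : Finset (κ₁ × κ₂ → ℕ))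
    (hS : ∀ M, M ∈ S ↔ (∀ i, ∑ j, M (i, j) = α i) ∧ ∀ j, ∑ i, M (i, j) = β j) :
    ∑ σ : Equiv.Perm ι, #{c : ι → κ₁ | content c = α ∧ c ∘ σ = c} *
      #{c : ι → κ₂ | content c = β ∧ c ∘ σ = c} = (Fintype.card ι).factorial * #S := by
  have h : ∀ σ : Equiv.Perm ι, #{c : ι → κ₁ | content c = α ∧ c ∘ σ = c} *
      #{c : ι → κ₂ | content c = β ∧ c ∘ σ = c} =
      ∑ M ∈ S, #{c : ι → κ₁ × κ₂ | content c = M ∧ c ∘ σ = c} := by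
    intro σ
    rw [← card_product]
    have : ∀ M ∈ S, #{c : ι → κ₁ × κ₂ | content c = M ∧ c ∘ σ = c} =
        #{c ∈ ({c : ι → κ₁ × κ₂ | content c ∈ S ∧ c ∘ σ = c} : Finset _) | content c = M} := by
      intro M hM
      congr 1
      ext c
      simp only [mem_filter, mem_univ, true_and]
      constructor
      · rintro ⟨rfl, h⟩
        exact ⟨⟨hM, h⟩, rfl⟩
      · rintro ⟨⟨_, h⟩, h'⟩
        exact ⟨h', h⟩
    rw [sum_congr rfl this, ← card_eq_sum_card_fiberwise fun c hc => by
      simpa using (mem_filter.1 hc).2.1]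
    refine card_bij (fun p _ => fun a => (p.1 a, p.2 a)) ?_ ?_ ?_
    · rintro ⟨c, d⟩ hp
      simp only [mem_product, mem_filter, mem_univ, true_and] at hp ⊢
      obtain ⟨⟨h1, h2⟩, h3, h4⟩ := hp
      refine ⟨(hS _).2 ⟨fun i => ?_, fun j => ?_⟩, ?_⟩
      · rw [← h1, ← content_fst]
      · rw [← h3, ← content_snd]
      · funext a
        exact Prod.ext (congrFun h2 a) (congrFun h4 a)
    · rintro ⟨c, d⟩ _ ⟨c', d'⟩ _ h
      refine Prod.ext (funext fun a => ?_) (funext fun a => ?_)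
      · exact congrArg Prod.fst (congrFun h a)
      · exact congrArg Prod.snd (congrFun h a)
    · intro c hc
      simp only [mem_filter, mem_univ, true_and, hS] at hc
      refine ⟨(fun a => (c a).1, fun a => (c a).2), ?_, rfl⟩
      simp only [mem_product, mem_filter, mem_univ, true_and]
      refine ⟨⟨funext fun i => ?_, ?_⟩, funext fun j => ?_, ?_⟩
      · rw [content_fst, hc.1.1]
      · funext a
        exact congrArg Prod.fst (congrFun hc.2 a)
      · rw [content_snd, hc.1.2]
      · funext a
        exact congrArg Prod.snd (congrFun hc.2 a)
  simp only [h]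
  rw [sum_comm, sum_congr rfl fun M hM => sum_perm_card_fixed_colorings ?_, sum_const,
    smul_eq_mul, mul_comm]
  rw [← hα, Fintype.sum_prod_type]
  exact sum_congr rfl fun i _ => ((hS M).1 hM).1 i

end Colorings

theorem coloringCharacter_mem_closure {n r : ℕ} (α : Fin r → ℕ) :
    (fun σ : Equiv.Perm (Fin n) =>
      ((Finset.card {c : Fin n → Fin r | content c = α ∧ c ∘ σ = c} : ℕ) : ℂ)) ∈
      AddSubgroup.closure (irreducibleCharacters (Equiv.Perm (Fin n))) := by
  let φ : Equiv.Perm (Fin n) →* Equiv.Perm {c : Fin n → Fin r // content c = α} :=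
    { toFun := fun σ =>
        { toFun := fun c => ⟨c.1 ∘ σ.symm, by rw [content_comp_perm, c.2]⟩
          invFun := fun c => ⟨c.1 ∘ σ, by rw [content_comp_perm, c.2]⟩
          left_inv := fun c => by ext; simp
          right_inv := fun c => by ext; simp }
      map_one' := rfl
      map_mul' := fun σ τ => rfl }
  convert permutationCharacter_mem_closure φ using 2 with σ
  rw [← Fintype.card_subtype]
  congr 1
  refine Fintype.card_congr ((Equiv.subtypeSubtypeEquivSubtypeInter _ _).symm.trans
    (Equiv.subtypeEquivRight fun c => ?_))
  rw [Subtype.ext_iff]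
  change _ ↔ c.1 ∘ σ.symm = c.1
  constructor
  · intro h
    conv_lhs => rw [← h]
    funext a
    simp
  · intro h
    conv_lhs => rw [← h]
    funext a
    simp

/-! ### Cauchy's determinant and geometric series -/

section Cauchy

open Finset Matrix

/-- The polynomial identity behind Cauchy's determinant. Both the matrix on the left and the
diagonal matrix with entries `∏ k ≠ i, (y i - y k)` are a (projective) Vandermonde matrix times the
matrix of coefficients of the polynomials `∏ k ≠ j, (1 - t * y k)`. -/
theorem det_prod_one_sub_mul {R : Type*} [CommRing R] [IsDomain R] {r : ℕ} (x y : Fin r → R)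
    (hy : Function.Injective y) :
    (of fun i j => ∏ k ∈ univ.erase j, (1 - x i * y k)).det =
      (vandermonde x).det * (vandermonde y).det := by
  classical
  let p : Fin r → Polynomial R := fun j =>
    ∏ k ∈ univ.erase j, (1 - Polynomial.X * Polynomial.C (y k))
  let C : Matrix (Fin r) (Fin r) R := of fun k j => (p j).coeff k
  have hrpos : ∀ j : Fin r, #(univ.erase j) = r - 1 := fun j => by simp
  -- homogenization of `p j`
  have key : ∀ (a b : R) (j : Fin r), ∑ k : Fin r, a ^ (k : ℕ) * b ^ (k.rev : ℕ) * (p j).coeff k =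
      ∏ k ∈ univ.erase j, (b - a * y k) := by
    have gen : ∀ (a b : R) (s : Finset (Fin r)),
        ∑ k ∈ range (#s + 1), a ^ k * b ^ (#s - k) *
          (∏ k ∈ s, (1 - Polynomial.X * Polynomial.C (y k))).coeff k =
        ∏ k ∈ s, (b - a * y k) := by
      intro a b s
      induction s using Finset.induction_on with
      | empty => simp
      | insert c s hc ih =>
        rw [prod_insert hc, prod_insert hc, card_insert_of_notMem hc, ← ih]
        set q := ∏ k ∈ s, (1 - Polynomial.X * Polynomial.C (y k)) with hq
        have hdeg : q.coeff (#s + 1) = 0 := by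
          apply Polynomial.coeff_eq_zero_of_natDegree_lt
          refine lt_of_le_of_lt (Polynomial.natDegree_prod_le _ _) ?_
          refine lt_of_le_of_lt (sum_le_card_nsmul _ _ 1 fun k _ => ?_) (by simp)
          compute_degree
        have h1 : (1 - Polynomial.X * Polynomial.C (y c)) * q =
            q - Polynomial.X * (Polynomial.C (y c) * q) := by ring
        rw [h1]
        simp only [Polynomial.coeff_sub, mul_sub, sum_sub_distrib, sub_mul]
        congr 1
        · rw [sum_range_succ, hdeg, mul_zero, add_zero, mul_sum]
          refine sum_congr rfl fun k hk => ?_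
          rw [mem_range] at hk
          rw [show #s + 1 - k = (#s - k) + 1 by omega]
          ring
        · rw [sum_range_succ']
          simp only [Polynomial.coeff_X_mul, Polynomial.coeff_C_mul, Polynomial.coeff_X_mul_zero,
            mul_zero, add_zero, mul_sum]
          refine sum_congr rfl fun k hk => ?_
          rw [show #s + 1 - (k + 1) = #s - k by omega]
          ring
    intro a b j
    rw [← gen a b (univ.erase j), hrpos, Nat.sub_add_cancel (Fin.pos j), ← Fin.sum_univ_eq_sum_range
      (fun k => a ^ k * b ^ (r - 1 - k) * (p j).coeff k)]
    refine sum_congr rfl fun k _ => ?_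
    rw [Fin.val_rev]
    congr 3
    omega
  have h1 : (of fun i j => ∏ k ∈ univ.erase j, (1 - x i * y k)) = vandermonde x * C := by
    ext i j
    rw [mul_apply, of_apply, ← key]
    refine sum_congr rfl fun k _ => ?_
    simp [C, vandermonde_apply]
  have h2 : diagonal (fun i => ∏ k ∈ univ.erase i, (y i - y k)) = projVandermonde 1 y * C := by
    ext i j
    have : (projVandermonde 1 y * C) i j = ∏ k ∈ univ.erase j, (y i - 1 * y k) := by
      rw [mul_apply, ← key]
      exact sum_congr rfl fun k _ => by simp [C, projVandermonde_apply]
    rw [this, diagonal_apply]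
    split_ifs with h
    · subst h
      simp
    · rw [eq_comm]
      exact prod_eq_zero (mem_erase.2 ⟨h, mem_univ i⟩) (by simp)
  have h3 : (projVandermonde 1 y).det ≠ 0 := by
    rw [det_projVandermonde, prod_ne_zero_iff]
    intro i _
    rw [prod_ne_zero_iff]
    intro j hj
    simp only [Pi.one_apply, one_mul]
    exact sub_ne_zero.2 fun h => (mem_Ioi.1 hj).ne (hy h)
  have h4 : C.det = (vandermonde y).det := by
    apply mul_left_cancel₀ h3
    rw [← det_mul, ← h2, det_diagonal, det_projVandermonde, det_vandermonde]
    have hsplit : ∀ i : Fin r, ∏ k ∈ univ.erase i, (y i - y k) =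
        (∏ k ∈ Ioi i, (y i - y k)) * ∏ k ∈ Iio i, (y i - y k) := by
      intro i
      rw [← prod_union]
      · refine prod_congr ?_ fun _ _ => rfl
        ext k
        simp only [mem_erase, mem_univ, and_true, mem_union, mem_Ioi, mem_Iio]
        rw [ne_iff_lt_or_gt, or_comm]
      · rw [Finset.disjoint_left]
        intro k hk hk'
        exact lt_asymm (mem_Ioi.1 hk) (mem_Iio.1 hk')
    simp only [hsplit, prod_mul_distrib, Pi.one_apply, one_mul]
    congr 1
    exact prod_comm' (by simp)
  rw [h1, det_mul, h4]

end Cauchy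

section Geometric

open Finset MvPowerSeries

variable {σ : Type*}

/-- The geometric series of the monomial with exponent `e`. -/
noncomputable def geomSeries (e : σ →₀ ℕ) : MvPowerSeries σ ℤ :=
  open Classical in fun d => if ∃ k : ℕ, d = k • e then 1 else 0

open Classical in
theorem coeff_geomSeries (e d : σ →₀ ℕ) :
    coeff d (geomSeries e) = if ∃ k : ℕ, d = k • e then 1 else 0 := rfl

theorem geomSeries_mul_one_sub {e : σ →₀ ℕ} (he : e ≠ 0) :
    geomSeries e * (1 - monomial e 1) = 1 := by
  classical
  ext d
  rw [mul_sub, mul_one, map_sub, coeff_mul_monomial, mul_one, coeff_one, coeff_geomSeries,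
    coeff_geomSeries]
  by_cases h0 : d = 0
  · subst h0
    rw [if_pos ⟨0, by simp⟩, if_neg (by simpa using he), if_pos rfl, sub_zero]
  · rw [if_neg h0, sub_eq_zero]
    by_cases hk : ∃ k : ℕ, d = k • e
    · obtain ⟨k, rfl⟩ := hk
      cases k with
      | zero => simp at h0
      | succ k =>
        rw [if_pos ⟨_, rfl⟩, if_pos (by rw [add_smul, one_smul]; exact le_add_self),
          if_pos ⟨k, by rw [add_smul, one_smul, add_tsub_cancel_right]⟩]
    · rw [if_neg hk]
      split_ifs with h1 h2
      · obtain ⟨k, h2⟩ := h2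
        refine (hk ⟨k + 1, ?_⟩).elim
        rw [add_smul, one_smul, ← h2, tsub_add_cancel_of_le h1]
      · rfl
      · rfl

/-- A coefficient of a product of geometric series counts the representations of the exponent `d` as
a combination of the exponents `e p`. -/
theorem exists_coeff_prod_geomSeries {τ : Type*} [Fintype τ] (e : τ → σ →₀ ℕ)
    (he : ∀ p, e p ≠ 0) (d : σ →₀ ℕ) :
    ∃ S : Finset (τ → ℕ), (∀ M, M ∈ S ↔ ∑ p, M p • e p = d) ∧
      coeff d (∏ p, geomSeries (e p)) = #S := by
  classical
  let ψ : (τ → ℕ) → (τ →₀ σ →₀ ℕ) := fun M => Finsupp.equivFunOnFinite.symm fun p => M p • e p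
  have hψ : Function.Injective ψ := by
    intro M N h
    funext p
    have h1 : M p • e p = N p • e p := DFunLike.congr_fun h p
    obtain ⟨s, hs⟩ := Finsupp.ne_iff.1 (he p)
    have h2 := DFunLike.congr_fun h1 s
    simp only [Finsupp.smul_apply, smul_eq_mul] at h2
    exact Nat.eq_of_mul_eq_mul_right (Nat.pos_of_ne_zero hs) h2
  refine ⟨(finsuppAntidiag univ d).preimage ψ hψ.injOn, fun M => ?_, ?_⟩
  · rw [mem_preimage, mem_finsuppAntidiag]
    simp [ψ]
  · rw [coeff_prod]
    simp only [coeff_geomSeries]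
    simp only [prod_boole, mem_univ, true_imp_iff]
    rw [sum_boole, card_preimage]
    congr 2
    ext l
    simp only [mem_filter, Set.mem_range, and_congr_right_iff]
    intro _
    constructor
    · intro h
      choose M hM using h
      exact ⟨M, by ext1 p; exact (hM p).symm⟩
    · rintro ⟨M, rfl⟩ p
      exact ⟨M p, rfl⟩

end Geometric

section Kernel

open Finset MvPowerSeries Matrix

variable {r : ℕ}

/-- The exponent vector of `x ^ α * y ^ β`. -/
noncomputable def biExponent (α β : Fin r → ℕ) : Fin r ⊕ Fin r →₀ ℕ :=
  Finsupp.equivFunOnFinite.symm (Sum.elim α β)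

/-- The exponent vector of `x i * y j`. -/
noncomputable def pairExponent (i j : Fin r) : Fin r ⊕ Fin r →₀ ℕ :=
  Finsupp.single (Sum.inl i) 1 + Finsupp.single (Sum.inr j) 1

theorem pairExponent_ne_zero (i j : Fin r) : pairExponent i j ≠ 0 := by
  intro h
  have := DFunLike.congr_fun h (Sum.inl i)
  simp [pairExponent] at this

theorem monomial_pairExponent (i j : Fin r) :
    (monomial (pairExponent i j) 1 : MvPowerSeries (Fin r ⊕ Fin r) ℤ) =
      X (Sum.inl i) * X (Sum.inr j) := by
  rw [X, X, monomial_mul_monomial, mul_one, pairExponent]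

/-- Cauchy's determinant for formal power series. -/
theorem vandermonde_mul_vandermonde_mul_prod_geomSeries :
    (vandermonde fun i : Fin r => (X (Sum.inl i) : MvPowerSeries (Fin r ⊕ Fin r) ℤ)).det *
      (vandermonde fun i : Fin r => (X (Sum.inr i) : MvPowerSeries (Fin r ⊕ Fin r) ℤ)).det *
      ∏ p : Fin r × Fin r, geomSeries (pairExponent p.1 p.2) =
    (of fun i j : Fin r => geomSeries (pairExponent i j)).det := by
  have hX : Function.Injective
      fun i : Fin r => (X (Sum.inr i) : MvPowerSeries (Fin r ⊕ Fin r) ℤ) := by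
    intro i j h
    have := (X_inj (R := ℤ)).1 h
    simpa using this
  have : IsDomain (MvPowerSeries (Fin r ⊕ Fin r) ℤ) := NoZeroDivisors.to_isDomain _
  rw [← det_prod_one_sub_mul _ _ hX, Fintype.prod_prod_type, mul_comm, ← det_mul_column]
  congr 1
  ext1 i j
  simp only [of_apply]
  rw [← mul_prod_erase _ _ (mem_univ j), mul_assoc, ← prod_mul_distrib, prod_eq_one, mul_one]
  intro k _
  rw [← monomial_pairExponent, geomSeries_mul_one_sub (pairExponent_ne_zero i k)]

/-- Only the identity permutation can contribute to the coefficient, because `l` and `m` are both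
increasing. -/
theorem coeff_det_geomSeries {l m : Fin r → ℕ} (hl : StrictMono l) (hm : StrictMono m) :
    coeff (biExponent l m) (of fun i j : Fin r => geomSeries (pairExponent i j)).det =
      if l = m then 1 else 0 := by
  rw [← det_transpose, det_apply, map_sum]
  have hterm : ∀ w : Equiv.Perm (Fin r),
      coeff (biExponent l m) (∏ i, geomSeries (pairExponent i (w i))) =
        if m ∘ w = l then 1 else 0 := by
    intro w
    obtain ⟨S, hS, h⟩ := exists_coeff_prod_geomSeries (fun i => pairExponent i (w i))
      (fun i => pairExponent_ne_zero i (w i)) (biExponent l m)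
    rw [h]
    have hS' : ∀ M, M ∈ S ↔ M = l ∧ m ∘ w = l := by
      intro M
      have h1 : ∀ i, (∑ p, M p • pairExponent p (w p)) (Sum.inl i) = M i := by
        intro i
        rw [Finsupp.finsetSum_apply, sum_eq_single i]
        · simp [pairExponent]
        · intro b _ hb
          simp [pairExponent, hb]
        · simp
      have h2 : ∀ i, (∑ p, M p • pairExponent p (w p)) (Sum.inr (w i)) = M i := by
        intro i
        rw [Finsupp.finsetSum_apply, sum_eq_single i]
        · simp [pairExponent]
        · intro b _ hb
          simp [pairExponent, hb]
        · simp
      rw [hS]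
      constructor
      · intro hM
        have hMl : M = l := by
          funext i
          rw [← h1 i, hM]
          rfl
        refine ⟨hMl, ?_⟩
        funext i
        rw [← hMl, ← h2 i, hM]
        rfl
      · rintro ⟨hM, hw⟩
        ext s
        rcases s with i | j
        · rw [h1, hM]
          rfl
        · obtain ⟨i, rfl⟩ := w.surjective j
          rw [h2, hM, ← hw]
          rfl
    split_ifs with hw
    · have : S = {l} := by
        ext M
        rw [hS', mem_singleton]
        exact and_iff_left hw
      rw [this]
      simp
    · have : S = ∅ := by
        ext M
        rw [hS']
        simp [hw]
      rw [this]
      simp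
  have hone : ∀ w : Equiv.Perm (Fin r), m ∘ w = l ↔ l = m ∧ w = 1 := by
    intro w
    constructor
    · intro h
      have hlm : l = m := by
        rw [← hl.range_inj hm, ← h, w.surjective.range_comp]
      refine ⟨hlm, Equiv.ext fun i => hm.injective ?_⟩
      rw [hlm] at h
      exact congrFun h i
    · rintro ⟨rfl, rfl⟩
      rfl
  simp only [Matrix.transpose_apply, of_apply, Units.smul_def, map_zsmul, hterm, hone]
  rw [sum_eq_single 1]
  · simp
  · intro w _ hw
    simp [hw]
  · simp

end Kernel

/-! ### Frobenius' characters -/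

section Frobenius

open Finset MvPowerSeries Matrix

variable {n r : ℕ}

open Classical in
/-- Frobenius' formula for the irreducible character attached to a partition of `n` with first
column hook lengths (beta numbers) `l`: the determinant `∑ w, sign w * π (l - w)`, where `π α` is
the character of the permutation representation on the colorings of content `α`, and `π α = 0` if
some entry of `α` is negative. -/
noncomputable def frobeniusCharacter (l : Fin r → ℕ) (σ : Equiv.Perm (Fin n)) : ℤ :=
  ∑ w : Equiv.Perm (Fin r), (Equiv.Perm.sign w : ℤ) * if ∀ i, (w i : ℕ) ≤ l i then
    (#{c : Fin n → Fin r | content c = (fun i => l i - (w i : ℕ)) ∧ c ∘ σ = c} : ℤ) else 0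

theorem frobeniusCharacter_mem_closure (l : Fin r → ℕ) :
    (fun σ : Equiv.Perm (Fin n) => (frobeniusCharacter l σ : ℂ)) ∈
      AddSubgroup.closure (irreducibleCharacters (Equiv.Perm (Fin n))) := by
  classical
  have : (fun σ : Equiv.Perm (Fin n) => (frobeniusCharacter l σ : ℂ)) =
      ∑ w : Equiv.Perm (Fin r), if ∀ i, (w i : ℕ) ≤ l i then
        (Equiv.Perm.sign w : ℤ) • (fun σ : Equiv.Perm (Fin n) =>
          ((#{c : Fin n → Fin r | content c = (fun i => l i - (w i : ℕ)) ∧ c ∘ σ = c} : ℕ) : ℂ))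
        else 0 := by
    funext σ
    rw [Finset.sum_apply, frobeniusCharacter]
    push_cast
    refine sum_congr rfl fun w _ => ?_
    split_ifs <;> simp
  rw [this]
  refine sum_mem fun w _ => ?_
  split_ifs
  · refine AddSubgroup.zsmul_mem _ ?_ _
    convert coloringCharacter_mem_closure (n := n) fun i => l i - (w i : ℕ)
  · exact zero_mem _

theorem frobeniusCharacter_inv (l : Fin r → ℕ) (σ : Equiv.Perm (Fin n)) :
    frobeniusCharacter l σ⁻¹ = frobeniusCharacter l σ := by
  classical
  have : ∀ c : Fin n → Fin r, c ∘ ⇑σ⁻¹ = c ↔ c ∘ σ = c := by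
    intro c
    constructor
    · intro h
      conv_lhs => rw [← h]
      funext a
      simp
    · intro h
      conv_lhs => rw [← h]
      funext a
      simp
  simp only [frobeniusCharacter, this]

theorem frobeniusCharacter_one_mul_prod_factorial {l : Fin r → ℕ}
    (hl : ∑ i, l i = n + ∑ i : Fin r, (i : ℕ)) :
    frobeniusCharacter l (1 : Equiv.Perm (Fin n)) * ∏ i, ((l i).factorial : ℤ) =
      n.factorial * ∏ i, ∏ j ∈ Ioi i, ((l j : ℤ) - l i) := by
  classical
  rw [← det_vandermonde,
    det_eval_matrixOfPolynomials_eq_det_vandermonde (fun i => (l i : ℤ))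
      (fun i => descPochhammer ℤ i) (fun i => (descPochhammer_natDegree ℤ i))
      (fun i => monic_descPochhammer ℤ i), ← det_transpose, det_apply, frobeniusCharacter,
      sum_mul, mul_sum]
  refine sum_congr rfl fun w _ => ?_
  simp only [transpose_apply, of_apply, descPochhammer_eval_eq_descFactorial, Units.smul_def,
    zsmul_eq_mul]
  split_ifs with hw
  · have hsum : ∑ i, (l i - (w i : ℕ)) = Fintype.card (Fin n) := by
      have h1 : ∑ i, (w i : ℕ) = ∑ i : Fin r, (i : ℕ) := Equiv.sum_comp w fun i : Fin r => (i : ℕ)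
      have h2 : ∑ i, (l i - (w i : ℕ)) + ∑ i, (w i : ℕ) = ∑ i, l i := by
        rw [← sum_add_distrib]
        exact sum_congr rfl fun i _ => Nat.sub_add_cancel (hw i)
      rw [Fintype.card_fin]
      omega
    have h := card_colorings_mul_prod_factorial hsum
    have h3 : ∏ i, (l i).factorial =
        (∏ i, (l i - (w i : ℕ)).factorial) * ∏ i, (l i).descFactorial (w i) := by
      rw [← prod_mul_distrib]
      exact prod_congr rfl fun i _ => (Nat.factorial_mul_descFactorial (hw i)).symm
    have h4 : #{c : Fin n → Fin r | content c = (fun i => l i - (w i : ℕ)) ∧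
        c ∘ ⇑(1 : Equiv.Perm (Fin n)) = c} =
        #{c : Fin n → Fin r | content c = fun i => l i - (w i : ℕ)} := by
      simp
    rw [h4]
    have h5 : (#{c : Fin n → Fin r | content c = fun i => l i - (w i : ℕ)} : ℤ) *
        ∏ i, ((l i).factorial : ℤ) =
        n.factorial * ∏ i, ((l i).descFactorial (w i) : ℤ) := by
      rw [Fintype.card_fin] at h
      rw [← h]
      have := congrArg (fun t : ℕ => (t : ℤ)) h3
      push_cast at this ⊢
      rw [this]
      ring
    rw [mul_assoc, h5]
    simp
    ring
  · -- the falling factorial vanishes where the colorings would need a negative number of points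
    push Not at hw
    obtain ⟨i, hi⟩ := hw
    rw [prod_eq_zero (mem_univ i) (f := fun i => (((l i).descFactorial (w i) : ℕ) : ℤ))
      (by exact_mod_cast Nat.descFactorial_of_lt hi)]
    simp

theorem prod_X_pow_eq_monomial {σ ι : Type*} (s : Finset ι) (f : ι → σ) (a : ι → ℕ) :
    ∏ i ∈ s, (X (f i) : MvPowerSeries σ ℤ) ^ a i =
      monomial (∑ i ∈ s, Finsupp.single (f i) (a i)) 1 := by
  classical
  induction s using Finset.induction_on with
  | empty => simp
  | insert i s hi ih =>
    rw [prod_insert hi, sum_insert hi, ih, X_pow_eq, monomial_mul_monomial, mul_one]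

theorem det_vandermonde_mul_det_vandermonde_eq_sum :
    (vandermonde fun i : Fin r => (X (Sum.inl i) : MvPowerSeries (Fin r ⊕ Fin r) ℤ)).det *
      (vandermonde fun i : Fin r => (X (Sum.inr i) : MvPowerSeries (Fin r ⊕ Fin r) ℤ)).det =
    ∑ w : Equiv.Perm (Fin r), ∑ w' : Equiv.Perm (Fin r),
      ((Equiv.Perm.sign w : ℤ) * (Equiv.Perm.sign w' : ℤ)) •
        monomial (biExponent (fun i => (w i : ℕ)) fun i => (w' i : ℕ)) 1 := by
  rw [← det_transpose, ← det_transpose (vandermonde fun i : Fin r => X (Sum.inr i)), det_apply,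
    det_apply, sum_mul_sum]
  refine sum_congr rfl fun w _ => sum_congr rfl fun w' _ => ?_
  simp only [transpose_apply, vandermonde_apply, prod_X_pow_eq_monomial, Units.smul_def]
  rw [smul_mul_smul_comm, monomial_mul_monomial, mul_one]
  have : ∑ i, Finsupp.single (Sum.inl i) (w i : ℕ) + ∑ i, Finsupp.single (Sum.inr i) (w' i : ℕ) =
      biExponent (fun i : Fin r => (w i : ℕ)) fun i => (w' i : ℕ) := by
    ext s
    rcases s with i | i <;> simp [biExponent, Finsupp.single_apply]
  rw [this]

open Classical in
/-- Both sides count, up to the factor `n!`, the matrices with row sums `α` and column sums `β`. -/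
theorem factorial_mul_coeff_prod_geomSeries {α β : Fin r → ℕ} (hα : ∑ i, α i = n) :
    (n.factorial : ℤ) * coeff (biExponent α β)
      (∏ p : Fin r × Fin r, geomSeries (pairExponent p.1 p.2)) =
    ∑ σ : Equiv.Perm (Fin n), (#{c : Fin n → Fin r | content c = α ∧ c ∘ σ = c} : ℤ) *
      #{c : Fin n → Fin r | content c = β ∧ c ∘ σ = c} := by
  obtain ⟨S, hS, h⟩ := exists_coeff_prod_geomSeries
    (fun p : Fin r × Fin r => pairExponent p.1 p.2)
    (fun p => pairExponent_ne_zero p.1 p.2) (biExponent α β)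
  rw [h]
  have := sum_perm_card_fixed_mul_card_fixed (ι := Fin n) (α := α) (β := β) (by simpa using hα) S ?_
  · rw [Fintype.card_fin] at this
    rw_mod_cast [← this]
  · intro M
    rw [hS, DFunLike.ext_iff, Sum.forall]
    refine and_congr (forall_congr' fun i => ?_) (forall_congr' fun i => ?_)
    · rw [Finsupp.finsetSum_apply, Fintype.sum_prod_type]
      simp [pairExponent, biExponent, Finsupp.single_apply]
    · rw [Finsupp.finsetSum_apply, Fintype.sum_prod_type_right]
      simp [pairExponent, biExponent, Finsupp.single_apply]

/-- Orthonormality of Frobenius' characters: their scalar products are coefficients in Cauchy's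
determinant. -/
theorem sum_frobeniusCharacter_mul {l m : Fin r → ℕ} (hl : StrictMono l) (hm : StrictMono m)
    (hn : ∑ i, l i = n + ∑ i : Fin r, (i : ℕ)) :
    ∑ σ : Equiv.Perm (Fin n), frobeniusCharacter l σ * frobeniusCharacter m σ =
      if l = m then (n.factorial : ℤ) else 0 := by
  classical
  have hle : ∀ w w' : Equiv.Perm (Fin r), (biExponent (fun i => (w i : ℕ)) fun i => (w' i : ℕ)) ≤
      biExponent l m ↔ (∀ i, (w i : ℕ) ≤ l i) ∧ ∀ i, (w' i : ℕ) ≤ m i := by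
    intro w w'
    rw [Finsupp.le_def, Sum.forall]
    rfl
  have hsub : ∀ w w' : Equiv.Perm (Fin r), biExponent l m -
      (biExponent (fun i => (w i : ℕ)) fun i => (w' i : ℕ)) =
      biExponent (fun i => l i - w i) fun i => m i - w' i := by
    intro w w'
    ext s
    rcases s with i | i <;> rfl
  have key := congrArg (coeff (biExponent l m))
    (vandermonde_mul_vandermonde_mul_prod_geomSeries (r := r))
  rw [coeff_det_geomSeries hl hm, det_vandermonde_mul_det_vandermonde_eq_sum, sum_mul, map_sum]
    at key
  have key2 : (n.factorial : ℤ) * (if l = m then 1 else 0) =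
      if l = m then (n.factorial : ℤ) else 0 := by simp
  rw [← key2, ← key, mul_sum]
  simp only [frobeniusCharacter, sum_mul_sum]
  rw [sum_comm]
  refine sum_congr rfl fun w _ => ?_
  rw [sum_comm, sum_mul, map_sum, mul_sum]
  refine sum_congr rfl fun w' _ => ?_
  rw [smul_mul_assoc, map_zsmul, coeff_monomial_mul, one_mul]
  simp only [hle, hsub]
  by_cases hw : ∀ i, (w i : ℕ) ≤ l i
  · by_cases hw' : ∀ i, (w' i : ℕ) ≤ m i
    · rw [if_pos ⟨hw, hw'⟩, smul_eq_mul, mul_left_comm, factorial_mul_coeff_prod_geomSeries,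
        mul_sum]
      · refine sum_congr rfl fun σ _ => ?_
        rw [if_pos hw, if_pos hw']
        ring
      · have h1 : ∑ i, (w i : ℕ) = ∑ i : Fin r, (i : ℕ) :=
          Equiv.sum_comp w fun i : Fin r => (i : ℕ)
        have h2 : ∑ i, (l i - (w i : ℕ)) + ∑ i, (w i : ℕ) = ∑ i, l i := by
          rw [← sum_add_distrib]
          exact sum_congr rfl fun i _ => Nat.sub_add_cancel (hw i)
        omega
    · simp [hw']
  · simp [hw]

theorem frobeniusCharacter_mem_irreducibleCharacters {l : Fin r → ℕ} (hl : StrictMono l)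
    (hn : ∑ i, l i = n + ∑ i : Fin r, (i : ℕ)) :
    (fun σ : Equiv.Perm (Fin n) => (frobeniusCharacter l σ : ℂ)) ∈
      irreducibleCharacters (Equiv.Perm (Fin n)) := by
  have hpos : 0 < frobeniusCharacter l (1 : Equiv.Perm (Fin n)) := by
    have h := frobeniusCharacter_one_mul_prod_factorial hn
    have h1 : (0 : ℤ) < n.factorial * ∏ i, ∏ j ∈ Ioi i, ((l j : ℤ) - l i) := by
      refine mul_pos (by exact_mod_cast n.factorial_pos)
        (prod_pos fun i _ => prod_pos fun j hj => ?_)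
      have := hl (mem_Ioi.1 hj)
      omega
    rw [← h] at h1
    exact pos_of_mul_pos_left h1 (prod_nonneg fun i _ => by positivity)
  refine mem_irreducibleCharacters_of_norm_one (frobeniusCharacter_mem_closure l) ?_
    (d := (frobeniusCharacter l (1 : Equiv.Perm (Fin n))).toNat) (by omega) ?_
  · simp only [frobeniusCharacter_inv]
    have := sum_frobeniusCharacter_mul hl hl hn
    rw [if_pos rfl] at this
    rw [Nat.card_eq_fintype_card, Fintype.card_perm, Fintype.card_fin]
    exact_mod_cast this
  · have : ((frobeniusCharacter l (1 : Equiv.Perm (Fin n))).toNat : ℤ) =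
      frobeniusCharacter l (1 : Equiv.Perm (Fin n)) := Int.toNat_of_nonneg hpos.le
    exact_mod_cast (congrArg (fun t : ℤ => (t : ℂ)) this).symm

theorem eq_of_frobeniusCharacter_eq {l m : Fin r → ℕ} (hl : StrictMono l) (hm : StrictMono m)
    (hn : ∑ i, l i = n + ∑ i : Fin r, (i : ℕ))
    (h : ∀ σ : Equiv.Perm (Fin n), frobeniusCharacter l σ = frobeniusCharacter m σ) : l = m := by
  by_contra hne
  have h1 := sum_frobeniusCharacter_mul hl hl hn
  have h2 := sum_frobeniusCharacter_mul hl hm hn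
  simp only [← h] at h2
  rw [h1, if_pos rfl, if_neg hne] at h2
  exact n.factorial_ne_zero (by exact_mod_cast h2)

end Frobenius

/-! ### Beta numbers, hook lengths and corner polynomials -/

section Maya

open Finset Polynomial

/-- The polynomial `1 + (X - 1) * ∑ x ∈ L, X ^ x` of a set `L` of beta numbers. Its coefficients
`1, -1, 1, …, 1` mark the corners of the associated partition. -/
noncomputable def cornerPoly (L : Finset ℕ) : ℤ[X] :=
  1 + (X - 1) * ∑ x ∈ L, X ^ x

theorem cornerPoly_injective : Function.Injective cornerPoly := by
  intro L M h
  have h1 : (∑ x ∈ L, X ^ x : ℤ[X]) = ∑ x ∈ M, X ^ x :=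
    mul_left_cancel₀ (X_sub_C_ne_zero (1 : ℤ)) (by simpa [cornerPoly] using h)
  ext d
  have h2 := congrArg (fun p : ℤ[X] => p.coeff d) h1
  simp only [finsetSum_coeff, coeff_X_pow, sum_ite_eq] at h2
  by_cases hL : d ∈ L <;> by_cases hM : d ∈ M <;> simp_all

theorem cornerPoly_eval_one (L : Finset ℕ) : (cornerPoly L).eval 1 = 1 := by
  simp [cornerPoly]

theorem cornerPoly_ne_zero (L : Finset ℕ) : cornerPoly L ≠ 0 := by
  intro h
  simpa [h] using cornerPoly_eval_one L

theorem cornerPoly_derivative_eval_one (L : Finset ℕ) :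
    (derivative (cornerPoly L)).eval 1 = #L := by
  simp [cornerPoly, eval_finsetSum]

theorem cornerPoly_derivative_derivative_eval_one (L : Finset ℕ) :
    (derivative (derivative (cornerPoly L))).eval 1 = 2 * ∑ x ∈ L, (x : ℤ) := by
  simp [cornerPoly, eval_finsetSum, derivative_X_pow]
  ring

theorem natDegree_cornerPoly_le {L : Finset ℕ} {N : ℕ} (hL : L ⊆ range N) :
    (cornerPoly L).natDegree ≤ N := by
  rcases L.eq_empty_or_nonempty with rfl | ⟨x, hx⟩
  · simp [cornerPoly]
  have hN : 1 ≤ N := by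
    have := mem_range.1 (hL hx)
    omega
  have h1 : (∑ x ∈ L, X ^ x : ℤ[X]).natDegree ≤ N - 1 := by
    refine natDegree_sum_le_of_forall_le _ _ fun y hy => ?_
    rw [natDegree_X_pow]
    have := mem_range.1 (hL hy)
    omega
  have h2 : (X - 1 : ℤ[X]).natDegree ≤ 1 := (natDegree_X_sub_C (1 : ℤ)).le
  have h3 : ((X - 1 : ℤ[X]) * ∑ x ∈ L, X ^ x).natDegree ≤ 1 + (N - 1) :=
    natDegree_mul_le_of_le h2 h1
  refine (natDegree_add_le _ _).trans (max_le (by simp) (by omega))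

/-- The number of hooks of length `d` in the partition with beta numbers `L`: a hook corresponds to
a pair consisting of `x ∈ L` and a smaller natural number `x - d ∉ L`. -/
def hookCount (L : Finset ℕ) (d : ℕ) : ℕ :=
  #{x ∈ L | d ≤ x ∧ x - d ∉ L}

theorem reflect_cornerPoly {L : Finset ℕ} {N : ℕ} (hL : L ⊆ range N) :
    reflect N (cornerPoly L) = X ^ N + (1 - X) * ∑ x ∈ L, X ^ (N - 1 - x) := by
  have h1 : cornerPoly L = 1 + ∑ x ∈ L, (X ^ (x + 1) - X ^ x) := by
    rw [cornerPoly, mul_sum]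
    congr 1
    exact sum_congr rfl fun x _ => by ring
  have hsum : ∀ s : Finset ℕ, s ⊆ L → reflect N (∑ x ∈ s, (X ^ (x + 1) - X ^ x) : ℤ[X]) =
      ∑ x ∈ s, (1 - X) * X ^ (N - 1 - x) := by
    intro s
    induction s using Finset.induction_on with
    | empty => simp
    | insert x s hx ih =>
      intro hs
      have hxN := mem_range.1 (hL (hs (mem_insert_self x s)))
      rw [sum_insert hx, sum_insert hx, reflect_add, ih ((subset_insert x s).trans hs),
        reflect_sub]
      congr 1
      rw [reflect_monomial, reflect_monomial, revAt_le (by omega), revAt_le (by omega),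
        show N - x = N - 1 - x + 1 by omega, show N - (x + 1) = N - 1 - x by omega]
      ring
  rw [h1, reflect_add, hsum L subset_rfl, ← mul_sum, ← C_1, reflect_C]
  simp

/-- The hook lengths are determined by the autocorrelation of the corner polynomial: writing
`r k` for its coefficient at lag `k`, the number of hooks of length `d` is
`∑ k > d, (k - d) * r k`. -/
theorem hookCount_eq_of_mul_reflect_eq {L M : Finset ℕ} {N : ℕ} (hL : L ⊆ range N)
    (hM : M ⊆ range N)
    (h : cornerPoly L * reflect N (cornerPoly L) = cornerPoly M * reflect N (cornerPoly M))
    {d : ℕ} (hd : 1 ≤ d) : hookCount L d = hookCount M d := by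
  -- the linear functional `X ^ a ↦ max (a - (N + d)) 0`
  let φ : ℤ[X] →ₗ[ℤ] ℤ := lsum fun a => ((a - (N + d) : ℕ) : ℤ) • LinearMap.id
  have hφ : ∀ a, φ (X ^ a) = ((a - (N + d) : ℕ) : ℤ) := by
    intro a
    simp [φ, lsum_apply, ← monomial_one_right_eq_X_pow, sum_monomial_index]
  suffices key : ∀ L : Finset ℕ, L ⊆ range N →
      φ (cornerPoly L * reflect N (cornerPoly L)) = hookCount L d by
    have := key L hL
    rw [h, key M hM] at this
    exact_mod_cast this.symm
  intro L hL
  have hlt : ∀ x ∈ L, x < N := fun x hx => mem_range.1 (hL hx)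
  have hexp : cornerPoly L * reflect N (cornerPoly L) =
      X ^ N + ∑ x ∈ L, (X ^ (N - 1 - x) - X ^ (N - 1 - x + 1)) +
      ∑ x ∈ L, (X ^ (N + x + 1) - X ^ (N + x)) -
      ∑ x ∈ L, ∑ y ∈ L, (X ^ (x + (N - 1 - y)) - 2 • X ^ (x + (N - 1 - y) + 1) +
        X ^ (x + (N - 1 - y) + 2)) := by
    have e1 : ∑ x ∈ L, (X ^ (N - 1 - x) - X ^ (N - 1 - x + 1) : ℤ[X]) =
        (1 - X) * ∑ x ∈ L, X ^ (N - 1 - x) := by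
      rw [mul_sum]
      exact sum_congr rfl fun x _ => by ring
    have e2 : ∑ x ∈ L, (X ^ (N + x + 1) - X ^ (N + x) : ℤ[X]) =
        X ^ N * (X - 1) * ∑ x ∈ L, X ^ x := by
      rw [mul_sum]
      exact sum_congr rfl fun x _ => by ring
    have e3 : ∑ x ∈ L, ∑ y ∈ L, (X ^ (x + (N - 1 - y)) - 2 • X ^ (x + (N - 1 - y) + 1) +
        X ^ (x + (N - 1 - y) + 2) : ℤ[X]) =
        (1 - X) ^ 2 * ((∑ x ∈ L, X ^ x) * ∑ x ∈ L, X ^ (N - 1 - x)) := by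
      rw [sum_mul_sum, mul_sum]
      refine sum_congr rfl fun x _ => ?_
      rw [mul_sum]
      refine sum_congr rfl fun y _ => ?_
      rw [two_smul]
      ring
    rw [e1, e2, e3, reflect_cornerPoly hL, cornerPoly]
    ring
  rw [hexp]
  simp only [map_add, map_sub, map_sum, map_nsmul, hφ]
  have t1 : ∑ x ∈ L, (((N - 1 - x - (N + d) : ℕ) : ℤ) - ((N - 1 - x + 1 - (N + d) : ℕ) : ℤ)) = 0 :=
    sum_eq_zero fun x hx => by
      have := hlt x hx
      omega
  have t2 : ∑ x ∈ L, (((N + x + 1 - (N + d) : ℕ) : ℤ) - ((N + x - (N + d) : ℕ) : ℤ)) =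
      ∑ x ∈ L, if d ≤ x then 1 else 0 :=
    sum_congr rfl fun x _ => by
      split_ifs <;> omega
  have t3 : ∑ x ∈ L, ∑ y ∈ L, (((x + (N - 1 - y) - (N + d) : ℕ) : ℤ) -
      2 • ((x + (N - 1 - y) + 1 - (N + d) : ℕ) : ℤ) + ((x + (N - 1 - y) + 2 - (N + d) : ℕ) : ℤ)) =
      ∑ x ∈ L, if d ≤ x ∧ x - d ∈ L then 1 else 0 := by
    refine sum_congr rfl fun x _ => ?_
    have : ∀ y ∈ L, (((x + (N - 1 - y) - (N + d) : ℕ) : ℤ) -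
        2 • ((x + (N - 1 - y) + 1 - (N + d) : ℕ) : ℤ) +
        ((x + (N - 1 - y) + 2 - (N + d) : ℕ) : ℤ)) = if d ≤ x ∧ y = x - d then 1 else 0 := by
      intro y hy
      have := hlt y hy
      rw [two_smul]
      split_ifs <;> omega
    rw [sum_congr rfl this]
    by_cases hdx : d ≤ x
    · simp [hdx]
    · simp [hdx]
  rw [t1, t2, t3, hookCount, card_filter]
  push_cast
  rw [show ((N - (N + d) : ℕ) : ℤ) = 0 by omega, zero_add, zero_add, ← sum_sub_distrib]
  refine sum_congr rfl fun x _ => ?_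
  by_cases h1 : d ≤ x <;> by_cases h2 : x - d ∈ L <;> simp [h1, h2]

/-- The hook length product, in the form in which it enters the degree formula. -/
theorem prod_factorial_eq_prod_hooks {L : Finset ℕ} {N : ℕ} (hL : L ⊆ range N) :
    ∏ x ∈ L, x.factorial =
      (∏ x ∈ L, ∏ y ∈ L with y < x, (x - y)) * ∏ d ∈ Icc 1 N, d ^ hookCount L d := by
  have h1 : ∀ x ∈ L, x.factorial = (∏ y ∈ L with y < x, (x - y)) *
      ∏ d ∈ Icc 1 N with d ≤ x ∧ x - d ∉ L, d := by
    intro x hx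
    have hxN := mem_range.1 (hL hx)
    have e1 : x.factorial = ∏ d ∈ Icc 1 x, d := by
      clear hx hxN
      induction x with
      | zero => simp
      | succ x ih => rw [prod_Icc_succ_top (by omega), ← ih, Nat.factorial_succ, mul_comm]
    rw [e1, ← prod_filter_mul_prod_filter_not _ (fun d => x - d ∈ L)]
    congr 1
    · refine prod_bij' (fun d _ => x - d) (fun y _ => x - y) ?_ ?_ ?_ ?_ ?_
      · intro d hd
        simp only [mem_filter, mem_Icc] at hd ⊢
        exact ⟨hd.2, by omega⟩
      · intro y hy
        simp only [mem_filter, mem_Icc] at hy ⊢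
        refine ⟨by omega, ?_⟩
        rw [show x - (x - y) = y by omega]
        exact hy.1
      · intro d hd
        simp only [mem_filter, mem_Icc] at hd
        omega
      · intro y hy
        simp only [mem_filter] at hy
        omega
      · intro d hd
        simp only [mem_filter, mem_Icc] at hd
        omega
    · refine prod_congr ?_ fun _ _ => rfl
      ext d
      simp only [mem_filter, mem_Icc]
      constructor
      · rintro ⟨⟨h1, h2⟩, h3⟩
        exact ⟨⟨h1, by omega⟩, h2, h3⟩
      · rintro ⟨⟨h1, _⟩, h2, h3⟩
        exact ⟨⟨h1, h2⟩, h3⟩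
  rw [prod_congr rfl h1, prod_mul_distrib]
  congr 1
  have h2 : ∀ d ∈ Icc 1 N, d ^ hookCount L d = ∏ x ∈ L with d ≤ x ∧ x - d ∉ L, d := by
    intro d _
    rw [prod_const, hookCount]
  rw [prod_congr rfl h2]
  exact prod_comm' (by simp; tauto)

/-- The beta numbers obtained from `L` by adding a run `[a, b)`, with the complement of a copy of
`L` at its lower end and a copy of `W` above its upper end. -/
def insertRun (a b : ℕ) (L W : Finset ℕ) : Finset ℕ :=
  (L ∪ (Ico a b \ L.image (a + ·))) ∪ W.image (b + ·)

theorem insertRun_subset {a b m k : ℕ} {L W : Finset ℕ} (hL : L ⊆ range m) (hW : W ⊆ range k)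
    (hab : a + m ≤ b) : insertRun a b L W ⊆ range (b + k) := by
  intro x hx
  simp only [insertRun, mem_union, mem_sdiff, mem_Ico, mem_image] at hx
  rw [mem_range]
  rcases hx with (hx | hx) | ⟨y, hy, rfl⟩
  · have := mem_range.1 (hL hx)
    omega
  · omega
  · have := mem_range.1 (hW hy)
    omega

/-- If all elements of `L` are below `a` and `b - a`, the corner polynomial of `insertRun a b L L`
is the one of `L` multiplied by `1 - X ^ a + X ^ b`; a general `W` allows iteration. -/
theorem cornerPoly_insertRun {a b m : ℕ} {L W : Finset ℕ} (hL : L ⊆ range m)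
    (hma : m ≤ a) (hab : a + m ≤ b) :
    cornerPoly (insertRun a b L W) =
      cornerPoly L - X ^ a * cornerPoly L + X ^ b * cornerPoly W := by
  have hsub : L.image (a + ·) ⊆ Ico a b := by
    intro x hx
    obtain ⟨y, hy, rfl⟩ := mem_image.1 hx
    have := mem_range.1 (hL hy)
    simp only [mem_Ico]
    omega
  have hd1 : Disjoint L (Ico a b \ L.image (a + ·)) := by
    rw [Finset.disjoint_left]
    intro x hx hx'
    have := mem_range.1 (hL hx)
    have := mem_Ico.1 (mem_sdiff.1 hx').1
    omega
  have hd2 : Disjoint (L ∪ (Ico a b \ L.image (a + ·))) (W.image (b + ·)) := by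
    rw [Finset.disjoint_left]
    intro x hx hx'
    obtain ⟨y, hy, rfl⟩ := mem_image.1 hx'
    rcases mem_union.1 hx with hx | hx
    · have := mem_range.1 (hL hx)
      omega
    · have := mem_Ico.1 (mem_sdiff.1 hx).1
      omega
  have himg : ∀ (c : ℕ) (S : Finset ℕ), (∑ x ∈ S.image (c + ·), X ^ x : ℤ[X]) =
      X ^ c * ∑ x ∈ S, X ^ x := by
    intro c S
    rw [sum_image (by simp), mul_sum]
    exact sum_congr rfl fun x _ => pow_add _ _ _
  have hsd : (∑ x ∈ Ico a b \ L.image (a + ·), X ^ x : ℤ[X]) =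
      ∑ x ∈ Ico a b, X ^ x - X ^ a * ∑ x ∈ L, X ^ x := by
    rw [eq_sub_iff_add_eq, ← himg, sum_sdiff hsub]
  have hgeom : (∑ x ∈ Ico a b, X ^ x : ℤ[X]) * (X - 1) = X ^ b - X ^ a :=
    geom_sum_Ico_mul X (by omega)
  rw [cornerPoly, insertRun, sum_union hd2, sum_union hd1, hsd, himg]
  simp only [cornerPoly]
  linear_combination hgeom

/-- The set with `k` more elements that consists of beta numbers of the same partition as `L`. -/
def shiftBy (k : ℕ) (L : Finset ℕ) : Finset ℕ :=
  range k ∪ L.image (k + ·)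

theorem shiftBy_subset {k m : ℕ} {L : Finset ℕ} (hL : L ⊆ range m) :
    shiftBy k L ⊆ range (k + m) := by
  intro x hx
  rw [shiftBy, mem_union, mem_range, mem_image] at hx
  rw [mem_range]
  rcases hx with hx | ⟨y, hy, rfl⟩
  · omega
  · have := mem_range.1 (hL hy)
    omega

theorem cornerPoly_shiftBy (k : ℕ) (L : Finset ℕ) :
    cornerPoly (shiftBy k L) = X ^ k * cornerPoly L := by
  have hd : Disjoint (range k) (L.image (k + ·)) := by
    rw [Finset.disjoint_left]
    intro x hx hx'
    obtain ⟨y, _, rfl⟩ := mem_image.1 hx'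
    have := mem_range.1 hx
    omega
  have hgeom : (∑ x ∈ range k, X ^ x : ℤ[X]) * (X - 1) = X ^ k - 1 := geom_sum_mul X k
  have himg : (∑ x ∈ L.image (k + ·), X ^ x : ℤ[X]) = X ^ k * ∑ x ∈ L, X ^ x := by
    rw [sum_image (by simp), mul_sum]
    exact sum_congr rfl fun x _ => pow_add _ _ _
  rw [cornerPoly, shiftBy, sum_union hd, himg, cornerPoly]
  linear_combination hgeom

end Maya

/-! ### Families of partitions with equal hook lengths -/

section Family

open Finset Polynomial

/-- The beta numbers whose corner polynomial is the one of `L` multiplied by the corner polynomial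
`1 - X ^ a + X ^ (3 * a)` of an `a × 2a` rectangle, for `L` contained in `[0, a)`. -/
def attachRectangle (a : ℕ) (L : Finset ℕ) : Finset ℕ :=
  insertRun a (3 * a) L L

/-- The beta numbers whose corner polynomial is the one of `L` multiplied by the corner polynomial
`1 - X ^ (2 * a) + X ^ (3 * a)` of the transposed rectangle and by `X ^ a`. The latter factor makes
the number of beta numbers the same as in `attachRectangle a L`. -/
def attachTransposedRectangle (a : ℕ) (L : Finset ℕ) : Finset ℕ :=
  shiftBy a (insertRun (2 * a) (3 * a) L L)

theorem cornerPoly_attachRectangle {a m : ℕ} {L : Finset ℕ} (hL : L ⊆ range m) (hm : m ≤ a) :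
    cornerPoly (attachRectangle a L) = cornerPoly L * (1 - X ^ a + X ^ (3 * a)) := by
  rw [attachRectangle, cornerPoly_insertRun hL hm (by omega)]
  ring

theorem cornerPoly_attachTransposedRectangle {a m : ℕ} {L : Finset ℕ} (hL : L ⊆ range m)
    (hm : m ≤ a) : cornerPoly (attachTransposedRectangle a L) =
      cornerPoly L * (X ^ a - X ^ (3 * a) + X ^ (4 * a)) := by
  rw [attachTransposedRectangle, cornerPoly_shiftBy, cornerPoly_insertRun hL (by omega) (by omega)]
  ring

theorem reflect_rectangle (a : ℕ) :
    reflect (4 * a) (1 - X ^ a + X ^ (3 * a) : ℤ[X]) = X ^ a - X ^ (3 * a) + X ^ (4 * a) := by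
  rw [reflect_add, reflect_sub, reflect_monomial, reflect_monomial, reflect_one,
    revAt_le (by omega), revAt_le (by omega), show 4 * a - a = 3 * a by omega,
    show 4 * a - 3 * a = a by omega]
  ring

theorem reflect_transposedRectangle (a : ℕ) :
    reflect (4 * a) (X ^ a - X ^ (3 * a) + X ^ (4 * a) : ℤ[X]) = 1 - X ^ a + X ^ (3 * a) := by
  rw [← reflect_rectangle, reflect_reflect]

/-- `IsHookFamily 𝓕 N ρ s`: all members of `𝓕` are sets of `ρ` beta numbers less than `N` of
partitions of `s` (a set `L` of `ρ` beta numbers belongs to a partition of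
`∑ x ∈ L, x - ρ * (ρ - 1) / 2`), and all of them have the same autocorrelation of
corner polynomials, hence the same hook lengths. -/
structure IsHookFamily (𝓕 : Finset (Finset ℕ)) (N ρ : ℕ) (s : ℤ) : Prop where
  subset_range : ∀ L ∈ 𝓕, L ⊆ range N
  card_eq : ∀ L ∈ 𝓕, #L = ρ
  sum_eq : ∀ L ∈ 𝓕, 2 * ∑ x ∈ L, (x : ℤ) + ρ = ρ ^ 2 + 2 * s
  corr_eq : ∀ L ∈ 𝓕, ∀ M ∈ 𝓕, cornerPoly L * reflect N (cornerPoly L) =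
    cornerPoly M * reflect N (cornerPoly M)

theorem card_eq_of_cornerPoly_eq_mul {L L' : Finset ℕ} {F : ℤ[X]} {e : ℕ}
    (h : cornerPoly L' = cornerPoly L * F) (hF : F.eval 1 = 1)
    (hF' : (derivative F).eval 1 = e) : #L' = #L + e := by
  have h1 := congrArg (fun p => (derivative p).eval 1) h
  simp only [derivative_mul, eval_add, eval_mul, cornerPoly_derivative_eval_one,
    cornerPoly_eval_one, hF, hF'] at h1
  zify
  linarith

theorem sum_eq_of_cornerPoly_eq_mul {L L' : Finset ℕ} {F : ℤ[X]} {e e' : ℤ}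
    (h : cornerPoly L' = cornerPoly L * F) (hF : F.eval 1 = 1)
    (hF' : (derivative F).eval 1 = e) (hF'' : (derivative (derivative F)).eval 1 = e') :
    2 * ∑ x ∈ L', (x : ℤ) = 2 * ∑ x ∈ L, (x : ℤ) + 2 * #L * e + e' := by
  have h1 := congrArg (fun p => (derivative (derivative p)).eval 1) h
  simp only [derivative_mul, derivative_add, eval_add, eval_mul, cornerPoly_derivative_eval_one,
    cornerPoly_derivative_derivative_eval_one, cornerPoly_eval_one, hF, hF', hF''] at h1
  linarith

theorem derivative_derivative_X_pow_eval_one (k : ℕ) :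
    (derivative (derivative (X ^ k : ℤ[X]))).eval 1 = k ^ 2 - k := by
  cases k with
  | zero => simp
  | succ k =>
    simp [derivative_X_pow]
    ring

/-- Attaching to every member the rectangle or its transpose doubles the family: the two corner
polynomials are reversals of each other, so the autocorrelation does not depend on the choice. -/
theorem IsHookFamily.exists_double {𝓕 : Finset (Finset ℕ)} {N ρ a : ℕ} {s : ℤ}
    (h𝓕 : IsHookFamily 𝓕 N ρ s) (hNa : N < a) :
    ∃ 𝓖, IsHookFamily 𝓖 (N + 4 * a) (ρ + 2 * a) (s + 2 * a ^ 2) ∧ #𝓖 = 2 * #𝓕 := by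
  classical
  set F : ℤ[X] := 1 - X ^ a + X ^ (3 * a) with hF
  set F' : ℤ[X] := X ^ a - X ^ (3 * a) + X ^ (4 * a) with hF'
  have hFd : F.natDegree ≤ 4 * a :=
    natDegree_add_le_of_degree_le ((natDegree_sub_le _ _).trans
      (max_le (by simp) (by rw [natDegree_X_pow]; omega))) (by rw [natDegree_X_pow]; omega)
  have hF'd : F'.natDegree ≤ 4 * a :=
    natDegree_add_le_of_degree_le ((natDegree_sub_le _ _).trans
      (max_le (by rw [natDegree_X_pow]; omega) (by rw [natDegree_X_pow]; omega)))
      (by rw [natDegree_X_pow])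
  have hF1 : F.eval 1 = 1 := by simp [hF]
  have hF'1 : F'.eval 1 = 1 := by simp [hF']
  have hFne : F ≠ 0 := fun h => by simp [h] at hF1
  have hF'ne : F' ≠ 0 := fun h => by simp [h] at hF'1
  have eF : (derivative F).eval 1 = ((2 * a : ℕ) : ℤ) := by
    simp [hF, derivative_X_pow]
    ring
  have eF' : (derivative F').eval 1 = ((2 * a : ℕ) : ℤ) := by
    simp [hF', derivative_X_pow]
    ring
  have eeF : (derivative (derivative F)).eval 1 = 8 * (a : ℤ) ^ 2 - 2 * a := by
    simp only [hF, derivative_add, derivative_sub, eval_add, eval_sub,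
      derivative_derivative_X_pow_eval_one]
    simp
    ring
  have eeF' : (derivative (derivative F')).eval 1 = 8 * (a : ℤ) ^ 2 - 2 * a := by
    simp only [hF', derivative_add, derivative_sub, eval_add, eval_sub,
      derivative_derivative_X_pow_eval_one]
    push_cast
    ring
  have h0 : ∀ L ∈ 𝓕, cornerPoly (attachRectangle a L) = cornerPoly L * F := fun L hL =>
    cornerPoly_attachRectangle (h𝓕.subset_range L hL) hNa.le
  have h1 : ∀ L ∈ 𝓕, cornerPoly (attachTransposedRectangle a L) = cornerPoly L * F' := fun L hL =>
    cornerPoly_attachTransposedRectangle (h𝓕.subset_range L hL) hNa.le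
  have hdeg : ∀ L ∈ 𝓕, (cornerPoly L).natDegree ≤ N := fun L hL =>
    natDegree_cornerPoly_le (h𝓕.subset_range L hL)
  have hmem : ∀ M ∈ 𝓕.image (attachRectangle a) ∪ 𝓕.image (attachTransposedRectangle a),
      M ⊆ range (N + 4 * a) ∧ ∃ L ∈ 𝓕, cornerPoly M = cornerPoly L * F ∨
        cornerPoly M = cornerPoly L * F' := by
    intro M hM
    rcases mem_union.1 hM with hM | hM
    · obtain ⟨L, hL, rfl⟩ := mem_image.1 hM
      refine ⟨?_, L, hL, Or.inl (h0 L hL)⟩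
      have hLN := h𝓕.subset_range L hL
      exact (insertRun_subset hLN hLN (by omega)).trans (range_subset_range.2 (by omega))
    · obtain ⟨L, hL, rfl⟩ := mem_image.1 hM
      refine ⟨?_, L, hL, Or.inr (h1 L hL)⟩
      have hLN := h𝓕.subset_range L hL
      exact (shiftBy_subset (insertRun_subset hLN hLN (by omega))).trans
        (range_subset_range.2 (by omega))
  refine ⟨𝓕.image (attachRectangle a) ∪ 𝓕.image (attachTransposedRectangle a), ⟨?_, ?_, ?_, ?_⟩, ?_⟩
  · exact fun M hM => (hmem M hM).1
  · intro M hM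
    obtain ⟨_, L, hL, h | h⟩ := hmem M hM
    · rw [card_eq_of_cornerPoly_eq_mul h hF1 eF, h𝓕.card_eq L hL]
    · rw [card_eq_of_cornerPoly_eq_mul h hF'1 eF', h𝓕.card_eq L hL]
  · intro M hM
    obtain ⟨_, L, hL, h | h⟩ := hmem M hM
    · have h3 := sum_eq_of_cornerPoly_eq_mul h hF1 eF eeF
      have h4 := h𝓕.sum_eq L hL
      rw [h𝓕.card_eq L hL] at h3
      push_cast at h3 ⊢
      linear_combination h3 + h4
    · have h3 := sum_eq_of_cornerPoly_eq_mul h hF'1 eF' eeF'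
      have h4 := h𝓕.sum_eq L hL
      rw [h𝓕.card_eq L hL] at h3
      push_cast at h3 ⊢
      linear_combination h3 + h4
  · have hcorr : ∀ M ∈ 𝓕.image (attachRectangle a) ∪ 𝓕.image (attachTransposedRectangle a),
        ∃ L ∈ 𝓕, cornerPoly M * reflect (N + 4 * a) (cornerPoly M) =
          cornerPoly L * reflect N (cornerPoly L) * (F * F') := by
      intro M hM
      obtain ⟨_, L, hL, h | h⟩ := hmem M hM
      · refine ⟨L, hL, ?_⟩
        rw [h, reflect_mul _ _ (hdeg L hL) hFd, reflect_rectangle]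
        ring
      · refine ⟨L, hL, ?_⟩
        rw [h, reflect_mul _ _ (hdeg L hL) hF'd, reflect_transposedRectangle]
        ring
    intro M hM M' hM'
    obtain ⟨L, hL, h⟩ := hcorr M hM
    obtain ⟨L', hL', h'⟩ := hcorr M' hM'
    rw [h, h', h𝓕.corr_eq L hL L' hL']
  · rw [card_union_of_disjoint, card_image_of_injOn, card_image_of_injOn, two_mul]
    · intro L hL L' hL' h
      have := congrArg cornerPoly h
      rw [h1 L hL, h1 L' hL'] at this
      exact cornerPoly_injective (mul_right_cancel₀ hF'ne this)
    · intro L hL L' hL' h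
      have := congrArg cornerPoly h
      rw [h0 L hL, h0 L' hL'] at this
      exact cornerPoly_injective (mul_right_cancel₀ hFne this)
    · -- `cornerPoly L` has degree less than `a`, so `X ^ a` does not divide `cornerPoly L * F`
      rw [Finset.disjoint_left]
      intro M hM hM'
      obtain ⟨L, hL, rfl⟩ := mem_image.1 hM
      obtain ⟨L', hL', h⟩ := mem_image.1 hM'
      have h2 := congrArg cornerPoly h
      rw [h0 L hL, h1 L' hL'] at h2
      have hdvd : X ^ a ∣ cornerPoly L := by
        refine ⟨cornerPoly L' * (1 - X ^ (2 * a) + X ^ (3 * a)) -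
          cornerPoly L * (X ^ (2 * a) - 1), ?_⟩
        rw [hF, hF'] at h2
        linear_combination -h2
      refine cornerPoly_ne_zero L (eq_zero_of_dvd_of_natDegree_lt hdvd ?_)
      rw [natDegree_X_pow]
      exact (hdeg L hL).trans_lt hNa

theorem exists_isHookFamily (i : ℕ) : ∃ 𝓕 ρ s, IsHookFamily 𝓕 (5 ^ i - 1) ρ s ∧
    12 * s + 1 = 25 ^ i ∧ #𝓕 = 2 ^ i := by
  induction i with
  | zero =>
    refine ⟨{∅}, 0, 0, ⟨?_, ?_, ?_, ?_⟩, by norm_num, by simp⟩ <;> simp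
  | succ i ih =>
    obtain ⟨𝓕, ρ, s, h, hs, hc⟩ := ih
    have hpos : 0 < 5 ^ i := by positivity
    obtain ⟨𝓖, hG, hcG⟩ := h.exists_double (a := 5 ^ i) (by omega)
    refine ⟨𝓖, ρ + 2 * 5 ^ i, s + 2 * ((5 ^ i : ℕ) : ℤ) ^ 2, ?_, ?_, ?_⟩
    · convert hG using 1
      rw [pow_succ]
      omega
    · push_cast
      rw [← pow_mul, mul_comm i 2, pow_mul, pow_succ (25 : ℤ) i]
      norm_num
      linarith
    · rw [hcG, hc, pow_succ, mul_comm]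

/-- Multiplication by the corner polynomial of a partition of `g * u + (2 * g + 1) * v` with two
corners, all of whose sides have length at least `g ≥ N`, enlarges the partitions and preserves the
number of members. -/
theorem IsHookFamily.exists_extend {𝓕 : Finset (Finset ℕ)} {N ρ g u v : ℕ} {s : ℤ}
    (h𝓕 : IsHookFamily 𝓕 N ρ s) (hN : N ≤ g) (hu : g ≤ u) (hv : g ≤ v) :
    ∃ 𝓖 N' ρ', IsHookFamily 𝓖 N' ρ' (s + g * u + (2 * g + 1) * v) ∧ #𝓖 = #𝓕 := by
  classical
  set F : ℤ[X] := 1 - X ^ g + X ^ (g + u) - X ^ (2 * g + u + 1) + X ^ (2 * g + u + 1 + v) with hF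
  let f : Finset ℕ → Finset ℕ := fun L => insertRun g (g + u) L (insertRun (g + 1) (g + 1 + v) L L)
  have hf : ∀ L ∈ 𝓕, cornerPoly (f L) = cornerPoly L * F := by
    intro L hL
    have hLN := h𝓕.subset_range L hL
    rw [cornerPoly_insertRun hLN hN (by omega), cornerPoly_insertRun hLN (by omega) (by omega), hF]
    ring
  have hF1 : F.eval 1 = 1 := by simp [hF]
  have hFne : F ≠ 0 := fun h => by simp [h] at hF1
  have eF : (derivative F).eval 1 = ((u + v : ℕ) : ℤ) := by
    simp [hF, derivative_X_pow]
    ring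
  have eeF : (derivative (derivative F)).eval 1 = ((g + u : ℕ) : ℤ) ^ 2 - (g + u : ℕ) -
      ((g : ℤ) ^ 2 - g) - (((2 * g + u + 1 : ℕ) : ℤ) ^ 2 - (2 * g + u + 1 : ℕ)) +
      (((2 * g + u + 1 + v : ℕ) : ℤ) ^ 2 - (2 * g + u + 1 + v : ℕ)) := by
    simp only [hF, derivative_add, derivative_sub, eval_add, eval_sub,
      derivative_derivative_X_pow_eval_one]
    simp
    ring
  have hdeg : ∀ L ∈ 𝓕, (cornerPoly L).natDegree ≤ N := fun L hL =>
    natDegree_cornerPoly_le (h𝓕.subset_range L hL)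
  have hsub : ∀ L ∈ 𝓕, f L ⊆ range (N + (F.natDegree + (2 * g + u + 1 + v))) := by
    intro L hL
    have hLN := h𝓕.subset_range L hL
    exact (insertRun_subset hLN (insertRun_subset hLN hLN (by omega)) (by omega)).trans
      (range_subset_range.2 (by omega))
  refine ⟨𝓕.image f, N + (F.natDegree + (2 * g + u + 1 + v)), ρ + (u + v), ⟨?_, ?_, ?_, ?_⟩, ?_⟩
  · intro M hM
    obtain ⟨L, hL, rfl⟩ := mem_image.1 hM
    exact hsub L hL
  · intro M hM
    obtain ⟨L, hL, rfl⟩ := mem_image.1 hM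
    rw [card_eq_of_cornerPoly_eq_mul (hf L hL) hF1 eF, h𝓕.card_eq L hL]
  · intro M hM
    obtain ⟨L, hL, rfl⟩ := mem_image.1 hM
    have h3 := sum_eq_of_cornerPoly_eq_mul (hf L hL) hF1 eF eeF
    have h4 := h𝓕.sum_eq L hL
    rw [h𝓕.card_eq L hL] at h3
    push_cast at h3 ⊢
    linear_combination h3 + h4
  · intro M hM M' hM'
    obtain ⟨L, hL, rfl⟩ := mem_image.1 hM
    obtain ⟨L', hL', rfl⟩ := mem_image.1 hM'
    rw [hf L hL, hf L' hL', reflect_mul _ _ (hdeg L hL) (Nat.le_add_right _ _),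
      reflect_mul _ _ (hdeg L' hL') (Nat.le_add_right _ _), mul_mul_mul_comm,
      h𝓕.corr_eq L hL L' hL', mul_mul_mul_comm]
  · refine card_image_of_injOn fun L hL L' hL' h => ?_
    have := congrArg cornerPoly h
    rw [hf L hL, hf L' hL'] at this
    exact cornerPoly_injective (mul_right_cancel₀ hFne this)

/-- Every `m ≥ 5 * g ^ 2` has the form `g * u + (2 * g + 1) * v` with `u, v ≥ g`: the residue of `m`
modulo `g` is the one of `v`. -/
theorem exists_eq_mul_add_mul {g m : ℕ} (hg : 0 < g) (hm : 5 * g ^ 2 ≤ m) :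
    ∃ u v, g ≤ u ∧ g ≤ v ∧ m = g * u + (2 * g + 1) * v := by
  have hr := Nat.mod_lt m hg
  have hdiv := Nat.div_add_mod m g
  set r := m % g
  set q := m / g
  have hq : 5 * g ≤ q := by
    rw [Nat.le_div_iff_mul_le hg]
    nlinarith
  -- `v = g + r` and `u = q - 2 * v - 1`
  refine ⟨q - 2 * (g + r) - 1, g + r, by omega, by omega, ?_⟩
  obtain ⟨u, hu⟩ : ∃ u, q = u + 2 * (g + r) + 1 := ⟨q - 2 * (g + r) - 1, by omega⟩
  have : q - 2 * (g + r) - 1 = u := by omega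
  rw [this, ← hdiv, hu]
  ring

theorem exists_isHookFamily_of_le {i n : ℕ} (hn : 6 * 25 ^ i ≤ n) :
    ∃ 𝓕 N ρ, IsHookFamily 𝓕 N ρ n ∧ #𝓕 = 2 ^ i := by
  obtain ⟨𝓕, ρ, s, h, hs, hc⟩ := exists_isHookFamily i
  have h25 : (1 : ℤ) ≤ 25 ^ i := one_le_pow₀ (by norm_num)
  obtain ⟨t, rfl⟩ : ∃ t : ℕ, s = t := ⟨s.toNat, by omega⟩
  have ht : t ≤ 25 ^ i := by
    zify
    omega
  have h55 : (5 ^ i) ^ 2 = 25 ^ i := by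
    rw [← pow_mul, mul_comm, pow_mul]
    norm_num
  obtain ⟨u, v, hu, hv, huv⟩ := exists_eq_mul_add_mul (g := 5 ^ i) (m := n - t) (by positivity)
    (by rw [h55]; omega)
  obtain ⟨𝓖, N', ρ', hG, hcG⟩ := h.exists_extend (g := 5 ^ i) (Nat.sub_le _ _) hu hv
  refine ⟨𝓖, N', ρ', ?_, hcG.trans hc⟩
  convert hG using 1
  have htn : t ≤ n := by omega
  have : n = t + 5 ^ i * u + (2 * 5 ^ i + 1) * v := by
    rw [add_assoc, ← huv, Nat.add_sub_cancel' htn]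
  rw [this]
  push_cast
  ring

end Family

/-! ### The multiplicity of a degree -/

section Multiplicity

open Finset

theorem le_maxDegreeMultiplicity {n : ℕ} {ι : Type*} (s : Finset ι)
    (χ : ι → Equiv.Perm (Fin n) → ℂ) (hχ : ∀ a ∈ s, χ a ∈ irreducibleCharacters _)
    (hinj : Set.InjOn χ s) {d : ℂ} (hd : ∀ a ∈ s, χ a 1 = d) :
    #s ≤ maxDegreeMultiplicity n := by
  classical
  rcases s.eq_empty_or_nonempty with rfl | ⟨a, ha⟩
  · simp
  have hcount : #s ≤ (symDegrees n).count d := by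
    rw [symDegrees, Multiset.count_map, ← card_image_of_injOn hinj]
    change _ ≤ #({χ ∈ (finite_irreducibleCharacters (Equiv.Perm (Fin n))).toFinset | d = χ 1})
    refine card_le_card fun ψ hψ => ?_
    obtain ⟨b, hb, rfl⟩ := mem_image.1 hψ
    exact mem_filter.2 ⟨by simpa using hχ b hb, (hd b hb).symm⟩
  have hdmem : d ∈ (symDegrees n).toFinset := by
    rw [Multiset.mem_toFinset, ← Multiset.one_le_count_iff_mem]
    exact le_trans (card_pos.2 ⟨a, ha⟩) hcount
  refine hcount.trans ?_
  rw [maxDegreeMultiplicity]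
  convert Finset.le_sup (f := fun d => (symDegrees n).count d) hdmem

/-- The degree of the character with beta numbers `L`, by the hook length formula. -/
theorem frobeniusCharacter_one_mul_prod_hooks {n N ρ : ℕ} {L : Finset ℕ} (hL : L ⊆ range N)
    (hc : #L = ρ) (hs : ∑ x ∈ L, x = n + ∑ i : Fin ρ, (i : ℕ)) :
    frobeniusCharacter (L.orderEmbOfFin hc) (1 : Equiv.Perm (Fin n)) *
      ((∏ d ∈ Icc 1 N, d ^ hookCount L d : ℕ) : ℤ) = n.factorial := by
  set l : Fin ρ → ℕ := ⇑(L.orderEmbOfFin hc) with hl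
  have hmono : StrictMono l := (L.orderEmbOfFin hc).strictMono
  have himg : univ.image l = L := by
    rw [hl]
    exact L.image_orderEmbOfFin_univ hc
  have hsum : ∑ i, l i = n + ∑ i : Fin ρ, (i : ℕ) := by
    rw [← hs, ← himg, sum_image hmono.injective.injOn]
  have hfac : ∏ x ∈ L, x.factorial = ∏ i, (l i).factorial := by
    rw [← himg, prod_image hmono.injective.injOn]
  have hvan : (((∏ x ∈ L, ∏ y ∈ L with y < x, (x - y) : ℕ)) : ℤ) =
      ∏ i, ∏ j ∈ Ioi i, ((l j : ℤ) - l i) := by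
    have h1 : ∏ x ∈ L, ∏ y ∈ L with y < x, (x - y) = ∏ j, ∏ i ∈ Iio j, (l j - l i) := by
      conv_lhs => rw [← himg]
      rw [prod_image hmono.injective.injOn]
      refine prod_congr rfl fun j _ => ?_
      rw [filter_image, prod_image hmono.injective.injOn]
      refine prod_congr ?_ fun _ _ => rfl
      ext i
      simp [hmono.lt_iff_lt]
    rw [h1, prod_comm' (t' := univ) (s' := fun i => Ioi i) (by simp)]
    push_cast
    refine prod_congr rfl fun i _ => prod_congr rfl fun j hj => ?_
    exact Nat.cast_sub (hmono (mem_Ioi.1 hj)).le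
  have hvan0 : ∏ i, ∏ j ∈ Ioi i, ((l j : ℤ) - l i) ≠ 0 := by
    refine prod_ne_zero_iff.2 fun i _ => prod_ne_zero_iff.2 fun j hj => ?_
    have := hmono (mem_Ioi.1 hj)
    omega
  have h := frobeniusCharacter_one_mul_prod_factorial hsum
  have h2 := congrArg (fun t : ℕ => (t : ℤ)) (hfac.symm.trans (prod_factorial_eq_prod_hooks hL))
  simp only [Nat.cast_mul, hvan] at h2
  rw [← Nat.cast_prod, h2] at h
  apply mul_right_cancel₀ hvan0
  rw [← h]
  ring

theorem IsHookFamily.card_le_maxDegreeMultiplicity {𝓕 : Finset (Finset ℕ)} {n N ρ : ℕ}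
    (h𝓕 : IsHookFamily 𝓕 N ρ n) : #𝓕 ≤ maxDegreeMultiplicity n := by
  classical
  rcases 𝓕.eq_empty_or_nonempty with rfl | ⟨L₀, hL₀⟩
  · simp
  have hsum : ∀ L ∈ 𝓕, ∑ x ∈ L, x = n + ∑ i : Fin ρ, (i : ℕ) := by
    intro L hL
    have h1 := h𝓕.sum_eq L hL
    have h2 : (∑ i : Fin ρ, (i : ℕ)) * 2 + ρ = ρ * ρ := by
      rw [Fin.sum_univ_eq_sum_range fun i => i, sum_range_id_mul_two]
      cases ρ with
      | zero => rfl
      | succ k =>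
        rw [Nat.add_sub_cancel]
        ring
    zify at h2 ⊢
    linarith
  have hcard : ∀ a : {L // L ∈ 𝓕}, #a.1 = ρ := fun a => h𝓕.card_eq a.1 a.2
  let l : {L // L ∈ 𝓕} → Fin ρ → ℕ := fun a => a.1.orderEmbOfFin (hcard a)
  have hmono : ∀ a, StrictMono (l a) := fun a => (a.1.orderEmbOfFin (hcard a)).strictMono
  have himg : ∀ a, univ.image (l a) = a.1 := fun a => a.1.image_orderEmbOfFin_univ (hcard a)
  have hlsum : ∀ a, ∑ i, l a i = n + ∑ i : Fin ρ, (i : ℕ) := by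
    intro a
    rw [← hsum a.1 a.2]
    conv_rhs => rw [← himg a]
    rw [sum_image (hmono a).injective.injOn]
  have hhook : ∀ L ∈ 𝓕, ∏ d ∈ Icc 1 N, d ^ hookCount L d = ∏ d ∈ Icc 1 N, d ^ hookCount L₀ d :=
    fun L hL => prod_congr rfl fun d hd => by
      rw [hookCount_eq_of_mul_reflect_eq (h𝓕.subset_range L hL) (h𝓕.subset_range L₀ hL₀)
        (h𝓕.corr_eq L hL L₀ hL₀) (mem_Icc.1 hd).1]
  have hne : ((∏ d ∈ Icc 1 N, d ^ hookCount L₀ d : ℕ) : ℤ) ≠ 0 := by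
    refine Nat.cast_ne_zero.2 (prod_ne_zero_iff.2 fun d hd => pow_ne_zero _ ?_)
    have := (mem_Icc.1 hd).1
    omega
  rw [← card_attach]
  refine le_maxDegreeMultiplicity 𝓕.attach
    (fun a σ => (frobeniusCharacter (l a) σ : ℂ))
    (fun a _ => frobeniusCharacter_mem_irreducibleCharacters (hmono a) (hlsum a)) ?_
    (d := (frobeniusCharacter (l ⟨L₀, hL₀⟩) (1 : Equiv.Perm (Fin n)) : ℂ)) ?_
  · intro a _ b _ hab
    have : l a = l b := eq_of_frobeniusCharacter_eq (hmono a) (hmono b) (hlsum a) fun σ => by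
      have := congrFun hab σ
      simpa using this
    apply Subtype.ext
    rw [← himg a, ← himg b, this]
  · intro a _
    have h1 := frobeniusCharacter_one_mul_prod_hooks (h𝓕.subset_range a.1 a.2) (hcard a)
      (hsum a.1 a.2)
    have h2 := frobeniusCharacter_one_mul_prod_hooks (h𝓕.subset_range L₀ hL₀)
      (hcard ⟨L₀, hL₀⟩) (hsum L₀ hL₀)
    rw [hhook a.1 a.2, ← h2] at h1
    exact_mod_cast mul_right_cancel₀ hne h1

theorem two_pow_le_maxDegreeMultiplicity {i n : ℕ} (hn : 6 * 25 ^ i ≤ n) :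
    2 ^ i ≤ maxDegreeMultiplicity n := by
  obtain ⟨𝓕, N, ρ, h, hc⟩ := exists_isHookFamily_of_le hn
  exact hc ▸ h.card_le_maxDegreeMultiplicity

end Multiplicity

end SymmetricGroupDegrees

theorem mainTheorem5 :
    (∃ i₀ : ℕ, ∀ i : ℕ, i₀ ≤ i → ∀ n : ℕ, 3 * 81 ^ i ≤ n → 2 ^ i ≤ maxDegreeMultiplicity n) ∧
    (∃ n₀ : ℕ, ∀ n : ℕ, n₀ ≤ n →
      (n : ℝ) ^ (1 / 7 : ℝ) ≤ (maxDegreeMultiplicity n : ℝ)) := by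
  have part1 : ∀ i : ℕ, 1 ≤ i → ∀ n : ℕ, 3 * 81 ^ i ≤ n → 2 ^ i ≤ maxDegreeMultiplicity n := by
    intro i hi n hn
    apply SymmetricGroupDegrees.two_pow_le_maxDegreeMultiplicity
    refine le_trans ?_ hn
    obtain ⟨j, rfl⟩ : ∃ j, i = j + 1 := ⟨i - 1, by omega⟩
    have : 25 ^ j ≤ 81 ^ j := Nat.pow_le_pow_left (by norm_num) j
    rw [pow_succ, pow_succ]
    omega
  refine ⟨⟨1, part1⟩, 3 * 81 ^ 13, fun n hn => ?_⟩
  -- choose `i` with `3 * 81 ^ i ≤ n < 3 * 81 ^ (i + 1)`; then `n ≤ 128 ^ i = (2 ^ i) ^ 7`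
  set i := Nat.log 81 (n / 3) with hi
  have hn3 : 81 ^ 13 ≤ n / 3 := by omega
  have h1 : 81 ^ i ≤ n / 3 := Nat.pow_log_le_self 81 (by omega)
  have h2 : n / 3 < 81 ^ (i + 1) := Nat.lt_pow_succ_log_self (by norm_num) _
  have h13 : 13 ≤ i := Nat.le_log_of_pow_le (by norm_num) hn3
  have h3 := part1 i (by omega) n (by omega)
  have h4 : n ≤ (2 ^ i) ^ 7 := by
    have h5 : n ≤ 243 * 81 ^ i := by
      rw [pow_succ] at h2
      omega
    refine h5.trans ?_
    obtain ⟨j, hj⟩ : ∃ j, i = 13 + j := ⟨i - 13, by omega⟩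
    have h128 : (2 ^ i) ^ 7 = 128 ^ i := by
      rw [← pow_mul, mul_comm i 7, pow_mul]
      norm_num
    rw [h128, hj, pow_add, pow_add, ← mul_assoc]
    exact Nat.mul_le_mul (by norm_num) (Nat.pow_le_pow_left (by norm_num) j)
  have h6 : (n : ℝ) ≤ (2 ^ i : ℝ) ^ 7 := by exact_mod_cast h4
  calc (n : ℝ) ^ (1 / 7 : ℝ) ≤ ((2 ^ i : ℝ) ^ 7) ^ (1 / 7 : ℝ) :=
        Real.rpow_le_rpow (by positivity) h6 (by norm_num)
    _ = 2 ^ i := by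
        rw [one_div]
        exact_mod_cast Real.pow_rpow_inv_natCast (n := 7) (by positivity : (0 : ℝ) ≤ 2 ^ i)
          (by norm_num)
    _ ≤ maxDegreeMultiplicity n := by exact_mod_cast h3
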